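/- Let $X=\{1,2,3,4\}$, $\sigma=(1\,2)(3\,4)$, $\pi=(1\,3)(2\,4)$. Let $\Gamma$ be the group generated by the transformations $\alpha,\beta,\gamma,a,b,c$ of the rooted tree $X^*$ of finite words given by $$\alpha=\sigma,\quad \beta=(\alpha,\gamma,\alpha,\gamma),\quad \gamma=(\beta,\varepsilon,\varepsilon,\beta),\quad a=\pi,\quad b=(a\alpha,a\alpha,c,c),\quad c=(b\beta,b\beta,b,b),$$ where $g=\tau(g_1,g_2,g_3,g_4)$ means $g(xw)=\tau(x)\,g_x(w)$ for $x\in X$, $w\in X^*$; write $g(x)=\tau(x)$ and $g|_x=g_x\in\Gamma$. Products are compositions, the right factor acting first. Let $\mathrm{IMG}(f)$ be the subgroup $\langle\alpha,\beta,\gamma,ac,cb\rangle$ of $\Gamma$ (it is the iterated monodromy group of $f(z,w)=((1-2z/w)^2,(1-2/w)^2)$). Let $\mathfrak M=X\times\Gamma$, whose elements $(x,h)$ are written $x\cdot h$, be the $\Gamma$-bimodule with $g\cdot(x\cdot h)=g(x)\cdot g|_xh$ and $(x\cdot h)\cdot g=x\cdot hg$. For a right $\Gamma$-space $\mathcal X$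 and a $\Gamma$-bimodule $\mathfrak N$, $\mathcal X\otimes\mathfrak N$ is the quotient of $\mathcal X\times\mathfrak N$ ($\mathfrak N$ discrete) by $\xi\cdot g\otimes m=\xi\otimes g\cdot m$. Let $\mathcal G$ be the set consisting of the six subgroups $\langle\beta,\gamma,b,c\rangle$, $\langle\alpha,\gamma,a,c\rangle$, $\langle\alpha,\beta,a,b\rangle$, $\langle\alpha,b,c\rangle$, $\langle\beta,a,c\gamma\rangle$, $\langle\gamma,a\alpha,b\beta\rangle$ of $\Gamma$ and all their pairwise and triple intersections. Let $\Xi$ be the (geometric realization of the) simplicial complex of finite chains of the poset, ordered by inclusion, of the subsets $G\cdot g\subset\Gamma$ with $G\in\mathcal G$, $g\in\Gamma$; $\Gamma$ acts on $\Xi$ from the right by $G\cdot h\mapsto G\cdot hg$. Let $\mathcal T_0\subset\Xi$ be the subcomplex spanned by the vertices that contain the identity. For $n\ge0$ put $\Xi_n=\Xi\otimes\mathfrak M^{\otimes n}$, $\mathcal T_n=\{\xi\otimes v:\xi\in\mathcal T_0,\ v\in X^n\}\subset\Xi_n$ and $\mathcal M_n=\Xi_n/\mathrm{IMG}(f)$,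 and for $g\in\Gamma$ put $K_{g,n}=\mathcal T_n\cap\mathcal T_n\cdot g$ and $\kappa_{g,n}:K_{g,n}\to K_{g^{-1},n}$, $\kappa_{g,n}(\xi)=\xi\cdot g^{-1}$. **Proposition.** For every $n\ge 0$ the space $\mathcal M_n$ is obtained by pasting together two copies $\mathcal T_n$ and $\mathcal T_n\cdot a$ of $\mathcal T_n$ along the sets $K_{g,n}$, $g\in\{a,b,c,a\alpha,b\beta,c\gamma,a\alpha\gamma,\alpha c\}$, identifying each point $\xi\in K_{g,n}$ of the first copy with the point $\kappa_{g,n}(\xi)\cdot a$ of the second copy, and by pasting the sets $K_{g,n}$, $g\in\{\alpha,\beta,\gamma\}$, to themselves inside each of the two copies, i.e. identifying $\xi$ with $\kappa_{g,n}(\xi)$ in $\mathcal T_n$ and $\xi\cdot a$ with $\kappa_{g,n}(\xi)\cdot a$ in $\mathcal T_n\cdot a$ for $\xi\in K_{g,n}$. Precisely: the map from the disjoint union $\mathcal T_n\sqcup\mathcal T_n\cdot a$ to $\mathcal M_n$ that sends every point to its $\mathrm{IMG}(f)$-orbit induces a homeomorphism onto $\mathcal M_n$ from the quotient of $\mathcal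 T_n\sqcup\mathcal T_n\cdot a$ by the equivalence relation generated by these identifications. -/

import Mathlib

open scoped Pointwise RightActions

/-! ### The automaton and the self-similar group `Γ` -/

/-- The alphabet `{1, 2, 3, 4}`; the letter `i + 1` is represented by `i : Fin 4`. -/
abbrev Letter : Type := Fin 4

/-- The permutation `σ = (1 2)(3 4)`. -/
def sigmaPerm : Equiv.Perm Letter := Equiv.swap 0 1 * Equiv.swap 2 3

/-- The permutation `π = (1 3)(2 4)`. -/
def piPerm : Equiv.Perm Letter := Equiv.swap 0 2 * Equiv.swap 1 3

/-- The twelve states of the automaton; juxtaposition of names stands for a product,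
e.g. `aαγ` is the product of `a`, `α`, `γ`
(see `perm_aα`, `perm_bβ`, `perm_cγ`, `perm_aαγ`, `perm_αc` below). -/
inductive State : Type
  | ε | α | β | γ | a | b | c | aα | bβ | cγ | aαγ | αc

namespace State

/-- The permutation induced by a state on the first level. -/
def out : State → Equiv.Perm Letter
  | α => sigmaPerm
  | a => piPerm
  | aα => piPerm * sigmaPerm
  | aαγ => piPerm * sigmaPerm
  | αc => sigmaPerm
  | _ => 1

/-- The coordinates `(g|₁, g|₂, g|₃, g|₄)` of the wreath recursion. -/
def next : State → Letter → State
  | β => ![α, γ, α, γ]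
  | γ => ![β, ε, ε, β]
  | b => ![aα, aα, c, c]
  | c => ![bβ, bβ, b, b]
  | bβ => ![a, aαγ, αc, cγ]
  | cγ => ![b, bβ, b, bβ]
  | aαγ => ![β, ε, ε, β]
  | αc => ![bβ, bβ, b, b]
  | _ => ![ε, ε, ε, ε]

/-- The action of a state on finite words: `g(xw) = g(x) g|ₓ(w)`. -/
def act : State → List Letter → List Letter
  | _, [] => []
  | s, x :: w => s.out x :: (s.next x).act w

theorem act_involutive (s : State) : Function.Involutive s.act := by
  intro w
  induction w generalizing s with
  | nil => rfl
  | cons x w ih =>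
    have h1 : ∀ (s : State) (x : Letter), s.out (s.out x) = x := by
      intro s; cases s <;> decide
    have h2 : ∀ (s : State) (x : Letter), s.next (s.out x) = s.next x := by
      intro s; cases s <;> intro x <;> fin_cases x <;> rfl
    simp only [act, h1, h2, ih]

/-- The transformation of the tree of finite words defined by a state. -/
def perm (s : State) : Equiv.Perm (List Letter) := (act_involutive s).toPerm

theorem perm_nil (s : State) : s.perm [] = [] := rfl

theorem perm_cons (s : State) (x : Letter) (w : List Letter) :
    s.perm (x :: w) = s.out x :: (s.next x).perm w := rfl

theorem length_perm (s : State) (w : List Letter) : (s.perm w).length = w.length := by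
  induction w generalizing s with
  | nil => rfl
  | cons x w ih => rw [perm_cons, List.length_cons, List.length_cons, ih]

theorem sigmaPerm_values :
    sigmaPerm 0 = 1 ∧ sigmaPerm 1 = 0 ∧ sigmaPerm 2 = 3 ∧ sigmaPerm 3 = 2 := by decide

theorem piPerm_values :
    piPerm 0 = 2 ∧ piPerm 1 = 3 ∧ piPerm 2 = 0 ∧ piPerm 3 = 1 := by decide

theorem perm_ε : ε.perm = 1 := by
  ext1 w
  induction w with
  | nil => rfl
  | cons x w ih =>
    have h : ε.next x = ε := by fin_cases x <;> rfl
    have h' : ε.out x = x := rfl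
    rw [perm_cons, h, h', ih]; rfl

theorem perm_aα : aα.perm = a.perm * α.perm := by
  ext1 w
  cases w with
  | nil => rfl
  | cons x w =>
    rw [Equiv.Perm.mul_apply, perm_cons, perm_cons, perm_cons]
    fin_cases x <;> simp [out, next, perm_ε, sigmaPerm_values, piPerm_values]

theorem perm_αc : αc.perm = α.perm * c.perm := by
  ext1 w
  cases w with
  | nil => rfl
  | cons x w =>
    rw [Equiv.Perm.mul_apply, perm_cons, perm_cons, perm_cons]
    fin_cases x <;> simp [out, next, perm_ε, sigmaPerm_values]

theorem perm_αc' : αc.perm = c.perm * α.perm := by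
  ext1 w
  cases w with
  | nil => rfl
  | cons x w =>
    rw [Equiv.Perm.mul_apply, perm_cons, perm_cons, perm_cons]
    fin_cases x <;> simp [out, next, perm_ε, sigmaPerm_values]

theorem perm_aαγ : aαγ.perm = a.perm * α.perm * γ.perm := by
  rw [← perm_aα]
  ext1 w
  cases w with
  | nil => rfl
  | cons x w =>
    rw [Equiv.Perm.mul_apply, perm_cons, perm_cons, perm_cons]
    fin_cases x <;> simp [out, next, perm_ε, sigmaPerm_values, piPerm_values]

theorem perm_bβ_cγ (n : ℕ) (w : List Letter) (hw : w.length = n) :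
    bβ.perm w = b.perm (β.perm w) ∧ cγ.perm w = c.perm (γ.perm w) := by
  have hs : ∀ (s : State) (w : List Letter), s.perm (s.perm w) = w := act_involutive
  induction n generalizing w with
  | zero => rw [List.length_eq_zero_iff.1 hw]; exact ⟨rfl, rfl⟩
  | succ n ih =>
    obtain ⟨x, w, rfl⟩ := List.exists_cons_of_length_eq_add_one hw
    have hw' : w.length = n := by simpa using hw
    have h1 := (ih w hw').1
    have h2 := (ih w hw').2
    have h3 := (ih (β.perm w) ((length_perm _ _).trans hw')).1
    simp only [perm_cons]
    fin_cases x <;> simp [out, next, perm_ε, perm_aα, perm_aαγ, perm_αc', h1, h2, h3, hs]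

theorem perm_bβ : bβ.perm = b.perm * β.perm := Equiv.ext fun w => (perm_bβ_cγ _ w rfl).1

theorem perm_cγ : cγ.perm = c.perm * γ.perm := Equiv.ext fun w => (perm_bβ_cγ _ w rfl).2

end State

/-- The group `Γ = ⟨α, β, γ, a, b, c⟩` of transformations of the tree of finite words
(the product is composition, `(gh)(w) = g(h(w))`). -/
def GammaSubgroup : Subgroup (Equiv.Perm (List Letter)) :=
  Subgroup.closure {State.α.perm, State.β.perm, State.γ.perm,
    State.a.perm, State.b.perm, State.c.perm}

abbrev Γ : Type := GammaSubgroup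

theorem State.perm_mem (s : State) : s.perm ∈ GammaSubgroup := by
  have hα : State.α.perm ∈ GammaSubgroup := Subgroup.subset_closure (by simp)
  have hβ : State.β.perm ∈ GammaSubgroup := Subgroup.subset_closure (by simp)
  have hγ : State.γ.perm ∈ GammaSubgroup := Subgroup.subset_closure (by simp)
  have ha : State.a.perm ∈ GammaSubgroup := Subgroup.subset_closure (by simp)
  have hb : State.b.perm ∈ GammaSubgroup := Subgroup.subset_closure (by simp)
  have hc : State.c.perm ∈ GammaSubgroup := Subgroup.subset_closure (by simp)
  cases s
  · rw [State.perm_ε]; exact one_mem _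
  · exact hα
  · exact hβ
  · exact hγ
  · exact ha
  · exact hb
  · exact hc
  · rw [State.perm_aα]; exact mul_mem ha hα
  · rw [State.perm_bβ]; exact mul_mem hb hβ
  · rw [State.perm_cγ]; exact mul_mem hc hγ
  · rw [State.perm_aαγ]; exact mul_mem (mul_mem ha hα) hγ
  · rw [State.perm_αc]; exact mul_mem hα hc

namespace Γ

/-- The element of `Γ` defined by a state of the automaton. -/
def ofState (s : State) : Γ := ⟨s.perm, s.perm_mem⟩

def α : Γ := ofState .α
def β : Γ := ofState .β
def γ : Γ := ofState .γ
def a : Γ := ofState .a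
def b : Γ := ofState .b
def c : Γ := ofState .c

/-- Every `g ∈ Γ` satisfies `g(xw) = g(x) g|ₓ(w)` for a letter `g(x)` and some `g|ₓ ∈ Γ`. -/
theorem exists_section (g : Γ) (x : Letter) :
    ∃ p : Letter × Γ, ∀ w : List Letter, g.1 (x :: w) = p.1 :: p.2.1 w := by
  obtain ⟨g, hg⟩ := g
  have key : ∀ s : State, ∀ x : Letter, ∃ p : Letter × Γ, ∀ w : List Letter,
      s.perm (x :: w) = p.1 :: p.2.1 w :=
    fun s x => ⟨(s.out x, ofState (s.next x)), fun w => s.perm_cons x w⟩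
  have hinv : ∀ s : State, s.perm⁻¹ = s.perm := fun s => by
    rw [inv_eq_iff_mul_eq_one]; exact Equiv.ext (State.act_involutive s)
  change ∃ p : Letter × Γ, ∀ w : List Letter, g (x :: w) = p.1 :: p.2.1 w
  induction hg using Subgroup.closure_induction'' generalizing x with
  | mem g hg =>
    rcases hg with rfl | rfl | rfl | rfl | rfl | rfl <;> exact key _ x
  | inv_mem g hg =>
    rcases hg with rfl | rfl | rfl | rfl | rfl | rfl <;> rw [hinv] <;> exact key _ x
  | one => exact ⟨(x, 1), fun w => rfl⟩
  | mul g h _ _ ihg ihh =>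
    obtain ⟨p, hp⟩ := ihh x
    obtain ⟨q, hq⟩ := ihg p.1
    exact ⟨(q.1, q.2 * p.2), fun w => by
      rw [Equiv.Perm.mul_apply, hp, hq]; rfl⟩

/-- The letter `g(x)`. -/
noncomputable def letter (g : Γ) (x : Letter) : Letter := (exists_section g x).choose.1

/-- The section `g|ₓ`. -/
noncomputable def sec (g : Γ) (x : Letter) : Γ := (exists_section g x).choose.2

/-- The equation which determines `g(x)` and `g|ₓ`. -/
theorem apply_cons (g : Γ) (x : Letter) (w : List Letter) :
    g.1 (x :: w) = g.letter x :: (g.sec x).1 w := (exists_section g x).choose_spec w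

theorem letter_sec_unique {g : Γ} {x y : Letter} {h : Γ}
    (H : ∀ w, g.1 (x :: w) = y :: h.1 w) : g.letter x = y ∧ g.sec x = h := by
  have H' : ∀ w, g.letter x :: (g.sec x).1 w = y :: h.1 w := fun w => by rw [← apply_cons, H]
  exact ⟨(List.cons.inj (H' [])).1, Subtype.ext (Equiv.ext fun w => (List.cons.inj (H' w)).2)⟩

theorem one_letter_sec (x : Letter) : (1 : Γ).letter x = x ∧ (1 : Γ).sec x = 1 :=
  letter_sec_unique fun _ => rfl

theorem mul_letter_sec (g h : Γ) (x : Letter) :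
    (g * h).letter x = g.letter (h.letter x) ∧
      (g * h).sec x = g.sec (h.letter x) * h.sec x :=
  letter_sec_unique fun w => by
    change g.1 (h.1 (x :: w)) = _
    rw [apply_cons, apply_cons]; rfl

/-- The wreath recursion on the elements defined by the states of the automaton. -/
theorem ofState_letter_sec (s : State) (x : Letter) :
    (ofState s).letter x = s.out x ∧ (ofState s).sec x = ofState (s.next x) :=
  letter_sec_unique fun w => s.perm_cons x w

end Γ

/-! ### Permutational bimodules and tensor products -/

/-- A permutational `G`-bimodule: a set with commuting left and right actions of `G`.
A right action of `G` is an action of the opposite group, written `x <• g`. -/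
structure PermBimodule (G : Type) [Group G] where
  carrier : Type
  left : MulAction G carrier
  right : MulAction Gᵐᵒᵖ carrier
  comm : SMulCommClass G Gᵐᵒᵖ carrier

attribute [instance] PermBimodule.left PermBimodule.right PermBimodule.comm

/-- A bimodule carries the discrete topology. -/
instance {G : Type} [Group G] (M : PermBimodule G) : TopologicalSpace M.carrier := ⊥

/-- The identifications `ξ·g ⊗ m = ξ ⊗ g·m`. -/
inductive TensorRel {G : Type} [Group G] (X : Type) [MulAction Gᵐᵒᵖ X] (M : PermBimodule G) :
    X × M.carrier → X × M.carrier → Prop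
  | mk (ξ : X) (g : G) (m : M.carrier) : TensorRel X M (ξ <• g, m) (ξ, g • m)

/-- The tensor product `X ⊗ M` of a right `G`-space and a `G`-bimodule, with the quotient
topology of the product topology. -/
def Tensor {G : Type} [Group G] (X : Type) [MulAction Gᵐᵒᵖ X] (M : PermBimodule G) : Type :=
  Quot (TensorRel X M)

instance {G : Type} [Group G] (X : Type) [MulAction Gᵐᵒᵖ X] [TopologicalSpace X]
    (M : PermBimodule G) : TopologicalSpace (Tensor X M) :=
  inferInstanceAs (TopologicalSpace (Quot (TensorRel X M)))

namespace Tensor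

variable {G : Type} [Group G] {X : Type} [MulAction Gᵐᵒᵖ X] {M : PermBimodule G}

/-- The point `ξ ⊗ m`. -/
def tmul (ξ : X) (m : M.carrier) : Tensor X M := Quot.mk _ (ξ, m)

theorem smul_tmul (ξ : X) (g : G) (m : M.carrier) :
    (tmul (ξ <• g) m : Tensor X M) = tmul ξ (g • m) := Quot.sound (.mk ξ g m)

/-- The right action `(ξ ⊗ m)·g = ξ ⊗ m·g`. -/
instance : MulAction Gᵐᵒᵖ (Tensor X M) where
  smul g := Quot.map (fun p => (p.1, g • p.2)) (by
    rintro _ _ ⟨ξ, h, m⟩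
    have := TensorRel.mk (M := M) ξ h (g • m)
    rwa [smul_comm h g m] at this)
  one_smul := by
    rintro ⟨ξ, m⟩
    exact congrArg (tmul ξ) (one_smul _ m)
  mul_smul := by
    rintro g h ⟨ξ, m⟩
    exact congrArg (tmul ξ) (mul_smul g h m)

end Tensor

namespace PermBimodule

variable {G : Type} [Group G]

/-- The group `G` as a bimodule over itself, the zeroth tensor power of every bimodule. -/
def unit (G : Type) [Group G] : PermBimodule G where
  carrier := G
  left := inferInstance
  right := inferInstance
  comm := inferInstance

/-- The left action `g·(x₁ ⊗ x₂) = (g·x₁) ⊗ x₂`. -/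
instance tensorLeft (M N : PermBimodule G) : MulAction G (Tensor M.carrier N) where
  smul g := Quot.map (fun p => (g • p.1, p.2)) (by
    rintro _ _ ⟨x, h, y⟩
    have := TensorRel.mk (M := N) (g • x) h y
    rwa [← smul_comm g (MulOpposite.op h) x] at this)
  one_smul := by
    rintro ⟨x, y⟩
    exact congrArg (fun x => Tensor.tmul x y) (one_smul G x)
  mul_smul := by
    rintro g h ⟨x, y⟩
    exact congrArg (fun x => Tensor.tmul x y) (mul_smul g h x)

/-- The tensor product of bimodules, `g₁·(x₁ ⊗ x₂)·g₂ = (g₁·x₁) ⊗ (x₂·g₂)`. -/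
def tensor (M N : PermBimodule G) : PermBimodule G where
  carrier := Tensor M.carrier N
  left := tensorLeft M N
  right := inferInstance
  comm := ⟨by rintro g h ⟨x, y⟩; rfl⟩

/-- The tensor power `M^{⊗ n}`. -/
def pow (M : PermBimodule G) : ℕ → PermBimodule G
  | 0 => unit G
  | n + 1 => (pow M n).tensor M

end PermBimodule

/-- The set `X·Γ`; the pair `(x, h)` is `x·h`. -/
@[ext]
structure LetterTimesΓ where
  letter : Letter
  elt : Γ

/-- The left action `g·(x·h) = g(x)·g|ₓh`. -/
noncomputable instance : MulAction Γ LetterTimesΓ where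
  smul g p := ⟨g.letter p.letter, g.sec p.letter * p.elt⟩
  one_smul := by
    rintro ⟨x, h⟩
    change (⟨(1 : Γ).letter x, (1 : Γ).sec x * h⟩ : LetterTimesΓ) = ⟨x, h⟩
    rw [(Γ.one_letter_sec x).1, (Γ.one_letter_sec x).2, one_mul]
  mul_smul := by
    rintro g k ⟨x, h⟩
    change (⟨(g * k).letter x, (g * k).sec x * h⟩ : LetterTimesΓ) =
      ⟨g.letter (k.letter x), g.sec (k.letter x) * (k.sec x * h)⟩
    rw [(Γ.mul_letter_sec g k x).1, (Γ.mul_letter_sec g k x).2, mul_assoc]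

/-- The right action `(x·h)·g = x·hg`. -/
instance : MulAction Γᵐᵒᵖ LetterTimesΓ where
  smul g p := ⟨p.letter, p.elt * g.unop⟩
  one_smul := by
    rintro ⟨x, h⟩
    exact congrArg (LetterTimesΓ.mk x) (mul_one h)
  mul_smul := by
    rintro g k ⟨x, h⟩
    exact congrArg (LetterTimesΓ.mk x) (mul_assoc h k.unop g.unop).symm

/-- The bimodule `𝔐 = X·Γ` associated with the self-similar group `Γ`. -/
noncomputable def bimoduleM : PermBimodule Γ where
  carrier := LetterTimesΓ
  left := inferInstance
  right := inferInstance
  comm := ⟨by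
    rintro g k ⟨x, h⟩
    exact congrArg (LetterTimesΓ.mk (g.letter x)) (mul_assoc (g.sec x) h k.unop).symm⟩

/-- The element `x₁ ⊗ ⋯ ⊗ xₙ` of `𝔐^{⊗ n}` given by a word of length `n`. -/
noncomputable def wordM : (n : ℕ) → (Fin n → Letter) → (bimoduleM.pow n).carrier
  | 0, _ => (1 : Γ)
  | n + 1, v => Tensor.tmul (M := bimoduleM) (wordM n (Fin.init v)) (LetterTimesΓ.mk (v (Fin.last n)) 1)

/-! ### The geometric realization of the order complex of a poset -/

/-- A point of the order complex of `P`, given by its barycentric coordinates: these are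
nonnegative, have sum one, and are nonzero only at the elements of a finite chain. -/
@[ext]
structure OrderComplex (P : Type) [PartialOrder P] where
  coord : P →₀ ℝ
  nonneg : ∀ p, 0 ≤ coord p
  sum_eq_one : (coord.sum fun _ t => t) = 1
  isChain : IsChain (· ≤ ·) (coord.support : Set P)

/-- The closed simplex spanned by a finite set `s` of vertices. -/
def OrderComplex.face {P : Type} [PartialOrder P] (s : Finset P) : Set (OrderComplex P) :=
  {x | x.coord.support ⊆ s}

/-- The weak topology: every closed simplex has the Euclidean topology of its barycentric
coordinates, and a set is closed when its intersection with every closed simplex is closed. -/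
instance (P : Type) [PartialOrder P] : TopologicalSpace (OrderComplex P) :=
  ⨆ s : {s : Finset P // IsChain (· ≤ ·) (s : Set P)},
    TopologicalSpace.coinduced (Subtype.val : OrderComplex.face s.1 → OrderComplex P)
      (TopologicalSpace.induced
        (fun (x : OrderComplex.face s.1) (p : s.1) => x.1.coord p.1) inferInstance)

/-- The simplicial map of order complexes induced by an isomorphism of posets. -/
noncomputable def OrderComplex.map {P Q : Type} [PartialOrder P] [PartialOrder Q] (e : P ≃o Q)
    (x : OrderComplex P) : OrderComplex Q where
  coord := x.coord.equivMapDomain e.toEquiv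
  nonneg q := x.nonneg _
  sum_eq_one := by
    rw [Finsupp.equivMapDomain_eq_mapDomain, Finsupp.sum_mapDomain_index (fun _ => rfl)
      (fun _ _ _ => rfl), x.sum_eq_one]
  isChain := by
    intro p hp q hq hpq
    have hp' : e.symm p ∈ (x.coord.support : Set P) := by simpa using hp
    have hq' : e.symm q ∈ (x.coord.support : Set P) := by simpa using hq
    have := x.isChain hp' hq' (fun h => hpq (e.symm.injective h))
    simpa using this

/-! ### The complexes `Ξₙ`, `𝒯ₙ` and `ℳₙ` -/

open Γ in
/-- The six finite subgroups `Γ_A, Γ_B, Γ_C, Γ_{A₁}, Γ_{B₁}, Γ_{C₁}`. -/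
def vertexGroups : Set (Subgroup Γ) :=
  {Subgroup.closure {β, γ, b, c}, Subgroup.closure {α, γ, a, c}, Subgroup.closure {α, β, a, b},
    Subgroup.closure {α, b, c}, Subgroup.closure {β, a, c * γ},
    Subgroup.closure {γ, a * α, b * β}}

/-- The set `𝒢` of the six subgroups and of all their pairwise and triple intersections. -/
def calG : Set (Subgroup Γ) :=
  {H | ∃ H₁ ∈ vertexGroups, ∃ H₂ ∈ vertexGroups, ∃ H₃ ∈ vertexGroups, H = H₁ ⊓ H₂ ⊓ H₃}

/-- The poset, ordered by inclusion, of the subsets `G·g` of `Γ` for `G ∈ 𝒢` and `g ∈ Γ`. -/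
abbrev CosetPoset : Type := {S : Set Γ // ∃ G ∈ calG, ∃ g : Γ, S = (G : Set Γ) <• g}

/-- The right translation `S ↦ S·g` of the poset of cosets. -/
def cosetTranslate (g : Γᵐᵒᵖ) : CosetPoset ≃o CosetPoset where
  toFun S := ⟨g • S.1, by
    obtain ⟨S, G, hG, h, rfl⟩ := S
    exact ⟨G, hG, h * g.unop, smul_smul g (MulOpposite.op h) (G : Set Γ)⟩⟩
  invFun S := ⟨g⁻¹ • S.1, by
    obtain ⟨S, G, hG, h, rfl⟩ := S
    exact ⟨G, hG, h * g⁻¹.unop, smul_smul g⁻¹ (MulOpposite.op h) (G : Set Γ)⟩⟩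
  left_inv S := Subtype.ext (inv_smul_smul g S.1)
  right_inv S := Subtype.ext (smul_inv_smul g S.1)
  map_rel_iff' := Set.smul_set_subset_smul_set_iff

/-- The simplicial complex `Ξ`. -/
abbrev Xi : Type := OrderComplex CosetPoset

/-- The right action of `Γ` on `Ξ` by the simplicial maps `G·h ↦ G·hg`. -/
noncomputable instance : MulAction Γᵐᵒᵖ Xi where
  smul g ξ := ξ.map (cosetTranslate g)
  one_smul ξ := by
    apply OrderComplex.ext
    ext S
    change ξ.coord ((cosetTranslate 1).symm S) = ξ.coord S
    congr 1
    exact Subtype.ext (by change (1 : Γᵐᵒᵖ)⁻¹ • S.1 = S.1; rw [inv_one, one_smul])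
  mul_smul g h ξ := by
    apply OrderComplex.ext
    ext S
    change ξ.coord ((cosetTranslate (g * h)).symm S) =
      ξ.coord ((cosetTranslate h).symm ((cosetTranslate g).symm S))
    congr 1
    exact Subtype.ext (by
      change (g * h)⁻¹ • S.1 = h⁻¹ • g⁻¹ • S.1; rw [mul_inv_rev, mul_smul])

/-- The complex `𝒯₀ ⊂ Ξ`, spanned by the vertices which contain the identity of `Γ`,
that is, by the elements of `𝒢`. -/
def T₀ : Set Xi := {ξ | ∀ S ∈ ξ.coord.support, (1 : Γ) ∈ S.1}

/-- The right `Γ`-space `Ξₙ = Ξ ⊗ 𝔐^{⊗ n}`. -/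
abbrev XiN (n : ℕ) : Type := Tensor Xi (bimoduleM.pow n)

/-- The set `𝒯ₙ = 𝒯₀ ⊗ Xⁿ ⊂ Ξₙ`. -/
def T (n : ℕ) : Set (XiN n) :=
  {x | ∃ ξ ∈ T₀, ∃ v : Fin n → Letter, x = Tensor.tmul ξ (wordM n v)}

/-- The set `K_{g,n} = 𝒯ₙ ∩ 𝒯ₙ·g`. -/
def K (g : Γ) (n : ℕ) : Set (XiN n) := T n ∩ (T n <• g)

/-- The map `κ_{g,n} : K_{g,n} → K_{g⁻¹,n}`, `ξ ↦ ξ·g⁻¹`. -/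
noncomputable def kappa (g : Γ) (n : ℕ) (ξ : K g n) : K g⁻¹ n :=
  ⟨ξ.1 <• g⁻¹, by
    obtain ⟨ξ, h, η, hη, rfl⟩ := ξ
    have e : (η <• g) <• g⁻¹ = η := by
      rw [MulOpposite.op_inv]; exact inv_smul_smul (MulOpposite.op g) η
    refine ⟨?_, Set.smul_mem_smul_set h⟩
    change (η <• g) <• g⁻¹ ∈ T n
    rwa [e]⟩

open Γ in
/-- The iterated monodromy group of `f` as the subgroup of index two of `Γ`. -/
def IMG : Subgroup Γ := Subgroup.closure {α, β, γ, a * c, c * b}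

/-- The space `ℳₙ = Ξₙ / IMG(f)` of orbits, with the quotient topology. -/
abbrev MN (n : ℕ) : Type := Quotient (MulAction.orbitRel IMG.op (XiN n))

/-- The image `[ξ]` of a point of `Ξₙ` in `ℳₙ`. -/
noncomputable def MN.mk {n : ℕ} (ξ : XiN n) : MN n := Quotient.mk _ ξ

open Γ in
/-- The elements whose maps paste one copy of `𝒯ₙ` to the other one. -/
def crossElements : Set Γ :=
  {a, b, c, a * α, b * β, c * γ, a * α * γ, α * c}

open Γ in
/-- The elements whose maps paste each copy of `𝒯ₙ` to itself. -/
def selfElements : Set Γ := {α, β, γ}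

/-- The pasting rules on the disjoint union of the copies `𝒯ₙ` and `𝒯ₙ·a`. -/
inductive PasteRel (n : ℕ) : T n ⊕ (T n <• Γ.a : Set (XiN n)) →
    T n ⊕ (T n <• Γ.a : Set (XiN n)) → Prop
  | cross (g : Γ) (hg : g ∈ crossElements) (ξ : K g n) :
      PasteRel n (.inl ⟨ξ.1, ξ.2.1⟩)
        (.inr ⟨(kappa g n ξ).1 <• Γ.a, Set.smul_mem_smul_set (kappa g n ξ).2.1⟩)
  | self_left (g : Γ) (hg : g ∈ selfElements) (ξ : K g n) :
      PasteRel n (.inl ⟨ξ.1, ξ.2.1⟩) (.inl ⟨(kappa g n ξ).1, (kappa g n ξ).2.1⟩)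
  | self_right (g : Γ) (hg : g ∈ selfElements) (ξ : K g n) :
      PasteRel n (.inr ⟨ξ.1 <• Γ.a, Set.smul_mem_smul_set ξ.2.1⟩)
        (.inr ⟨(kappa g n ξ).1 <• Γ.a, Set.smul_mem_smul_set (kappa g n ξ).2.1⟩)

/-- The space obtained by pasting: the topological quotient of the disjoint union of the two
copies by the equivalence relation generated by the pasting rules. -/
def Pasted (n : ℕ) : Type := Quot (PasteRel n)

instance (n : ℕ) : TopologicalSpace (Pasted n) :=
  inferInstanceAs (TopologicalSpace (Quot (PasteRel n)))

/-- The image in the pasted space of a point of one of the two copies. -/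
def Pasted.mk {n : ℕ} (x : T n ⊕ (T n <• Γ.a : Set (XiN n))) : Pasted n := Quot.mk _ x

/-!
Every point of `Ξₙ` is a translate of a point of `𝒯ₙ`, and `IMG(f)` is the kernel of the parity
homomorphism `Γ.parity`, which counts the factors `a, b, c` of a product of generators modulo two
(`mem_IMG_iff`). Hence the two copies `𝒯ₙ` and `𝒯ₙ·a` together meet every `IMG(f)`-orbit. The proof
has three parts.

*The pasting rules generate the orbit relation.* If `ξ ∈ 𝒯₀` and `ξ·h ∈ 𝒯₀`, then `h` lies in a
group `G ∈ 𝒢` which fixes `ξ` (`exists_calG_of_smul_mem_T₀`). Therefore two points of `𝒯ₙ` in one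
`Γ`-orbit have the form `ξ ⊗ v` and `ξ ⊗ h(v)` with `h ∈ G`, and they differ by the section `h|ᵥ`
(up to inversion). Every group of `𝒢` is generated by states of the automaton
(`mem_closure_states`), and the sections of states are states. So `ξ ⊗ v` is joined to `ξ ⊗ h(v)` by
a chain of points of `𝒯ₙ` in which neighbours differ by a state, which means that they are
identified by a pasting rule; the parity of the product of these states tells in which copy the
chain ends (`mk_copy_smul`). The odd states are exactly the elements which paste one copy to the
other.

*The groups of `𝒢` are generated by states.* The word problem in `Γ` is decided by following the
iterated sections of a word (`StateWord.isTrivial`). Each of the six finite groups is a product of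
two dihedral groups one of which normalizes the other, which bounds its elements by an explicit
list of words; their action on a suitable pair of words of length six separates all elements and is
enough to compute the intersections.

*Topology.* The map from the disjoint union of the copies to `ℳₙ` is a quotient map
(`isQuotientMap_toOrbit`). In the weak topology openness is tested on closed simplices, every
simplex of `Ξ` is a translate of a simplex of `𝒯₀`, and on it the orbit map `ξ ↦ [ξ ⊗ m]` factors
continuously through one of the copies (`exists_toOrbit_copy_eq`).
-/

/-! ### The word problem -/

instance : DecidableEq State := fun s t =>
  decidable_of_iff (s.ctorIdx = t.ctorIdx)
    ⟨fun h => by cases s <;> cases t <;> first | rfl | exact absurd h (by decide), fun h => h ▸ rfl⟩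

namespace StateWord

/-- The element of `Γ` defined by a word in the states of the automaton. -/
def eval (w : List State) : Γ := (w.map Γ.ofState).prod

theorem eval_cons (s : State) (w : List State) : eval (s :: w) = Γ.ofState s * eval w := by
  simp [eval]

theorem eval_append (v w : List State) : eval (v ++ w) = eval v * eval w := by
  simp [eval]

theorem ofState_mul_self (s : State) : Γ.ofState s * Γ.ofState s = 1 :=
  Subtype.ext (Equiv.ext (State.act_involutive s))

theorem ofState_inv (s : State) : (Γ.ofState s)⁻¹ = Γ.ofState s :=
  inv_eq_of_mul_eq_one_left (ofState_mul_self s)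

theorem ofState_ε : Γ.ofState .ε = 1 := Subtype.ext State.perm_ε

/-- Puts a state in front of a word, dropping the identity and cancelling equal neighbours
(all states are involutions). -/
def push (s : State) (w : List State) : List State :=
  if s = .ε then w else
    match w with
    | [] => [s]
    | t :: w => if s = t then w else s :: t :: w

theorem eval_push (s : State) (w : List State) : eval (push s w) = Γ.ofState s * eval w := by
  unfold push
  split_ifs with h
  · rw [h, ofState_ε, one_mul]
  · cases w with
    | nil => rfl
    | cons t w =>
      dsimp only
      split_ifs with h'
      · rw [h', eval_cons, ← mul_assoc, ofState_mul_self, one_mul]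
      · rw [eval_cons]

/-- The image of a letter under a word, and the word of states which represents the section. -/
def sec : List State → Letter → Letter × List State
  | [], x => (x, [])
  | s :: w, x => (s.out (sec w x).1, push (s.next (sec w x).1) (sec w x).2)

theorem eval_letter_sec (w : List State) (x : Letter) :
    (eval w).letter x = (sec w x).1 ∧ (eval w).sec x = eval (sec w x).2 := by
  induction w with
  | nil => exact Γ.one_letter_sec x
  | cons s w ih =>
    rw [eval_cons, (Γ.mul_letter_sec _ _ x).1, (Γ.mul_letter_sec _ _ x).2, ih.1, ih.2,
      (Γ.ofState_letter_sec _ _).1, (Γ.ofState_letter_sec _ _).2]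
    exact ⟨rfl, (eval_push _ _).symm⟩

/-- The elements of `Γ` fix the root. -/
theorem apply_nil (g : Γ) : g.1 [] = [] := by
  obtain ⟨g, hg⟩ := g
  change g [] = []
  induction hg using Subgroup.closure_induction with
  | mem g hg => rcases hg with rfl | rfl | rfl | rfl | rfl | rfl <;> rfl
  | one => rfl
  | mul g h _ _ ihg ihh => rw [Equiv.Perm.mul_apply, ihh, ihg]
  | inv g _ ih => rw [Equiv.Perm.inv_eq_iff_eq, ih]

/-- If a set of words is closed under sections and all its words act trivially on letters, then its
words act trivially on the whole tree. -/
theorem eval_eq_one_of_closed (R : List (List State))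
    (hR : ∀ w ∈ R, ∀ x, (sec w x).1 = x ∧ (sec w x).2 ∈ R) : ∀ w ∈ R, eval w = 1 := by
  have key : ∀ (l : List Letter), ∀ w ∈ R, (eval w).1 l = l := by
    intro l
    induction l with
    | nil => exact fun w _ => apply_nil _
    | cons x l ih =>
      intro w hw
      rw [Γ.apply_cons, (eval_letter_sec w x).1, (eval_letter_sec w x).2, (hR w hw x).1,
        ih _ (hR w hw x).2]
  exact fun w hw => Subtype.ext (Equiv.ext fun l => key l w hw)

/-- Adds to the list `R` of words the sections of the words in `fr`, then the sections of the new
words, and so on `n` times. -/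
def explore : ℕ → List (List State) → List (List State) → List (List State)
  | 0, R, _ => R
  | n + 1, R, fr =>
    let new := ((fr.flatMap fun w => [0, 1, 2, 3].map fun x => (sec w x).2).filter
      (fun w => !R.elem w)).dedup
    explore n (new ++ R) new

/-- Examines the iterated sections of a word; a positive answer shows that the word acts trivially.
Twelve rounds close the set of sections for all words which occur below. -/
def isTrivial (w : List State) : Bool :=
  let R := explore 12 [w] [w]
  R.all fun v => [0, 1, 2, 3].all fun x => (sec v x).1 == x && R.elem (sec v x).2

theorem mem_explore (n : ℕ) (R fr : List (List State)) : R ⊆ explore n R fr := by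
  induction n generalizing R fr with
  | zero => exact List.Subset.refl _
  | succ n ih => exact List.Subset.trans (List.subset_append_right _ _) (ih _ _)

theorem eval_eq_one_of_isTrivial {w : List State} (h : isTrivial w = true) : eval w = 1 := by
  refine eval_eq_one_of_closed (explore 12 [w] [w]) (fun v hv x => ?_) w
    (mem_explore _ _ _ (by simp))
  have h1 := List.all_eq_true.1 h v hv
  have h2 := List.all_eq_true.1 h1 x (by fin_cases x <;> simp)
  simpa using h2

end StateWord

/-! ### The six groups and their intersections -/

/-- Normal form in the group generated by a subgroup `P` and two involutions which normalize it. -/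
theorem exists_normal_form_of_involutions {G : Type*} [Group G] (P : Subgroup G) {u v : G}
    (hu : u * u = 1) (hv : v * v = 1) (hPu : ∀ p ∈ P, u * p * u ∈ P) (hPv : ∀ p ∈ P, v * p * v ∈ P)
    {k : ℕ} (hk : 0 < k) (huv : (u * v) ^ k ∈ P) {h : G}
    (hh : h ∈ Subgroup.closure (P ∪ {u, v} : Set G)) :
    ∃ p ∈ P, ∃ i < k, ∃ j < 2, h = p * ((u * v) ^ i * u ^ j) := by
  have hui : u⁻¹ = u := inv_eq_of_mul_eq_one_left hu
  have hvi : v⁻¹ = v := inv_eq_of_mul_eq_one_left hv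
  have hflip : ∀ z : ℤ, u * (u * v) ^ z = (u * v) ^ (-z) * u := fun z => by
    have := conj_zpow (i := z) (a := u) (b := u * v)
    have e : u * (u * v) * u⁻¹ = (u * v)⁻¹ := by
      rw [mul_inv_rev, hui, hvi, ← mul_assoc u u v, hu, one_mul]
    rw [e, inv_zpow'] at this
    rw [this, inv_mul_cancel_right]
  have hus : ∀ j < 2, ∃ j' < 2, u * u ^ j = u ^ j' := by
    intro j hj
    interval_cases j
    · exact ⟨1, by norm_num, by simp⟩
    · exact ⟨0, by norm_num, by simpa using hu⟩
  have hu_mul : ∀ p ∈ P, ∀ z : ℤ, ∀ j < 2, ∃ p' ∈ P, ∃ z' : ℤ, ∃ j' < 2,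
      u * (p * ((u * v) ^ z * u ^ j)) = p' * ((u * v) ^ z' * u ^ j') := by
    intro p hp z j hj
    obtain ⟨j', hj', e⟩ := hus j hj
    refine ⟨_, hPu p hp, -z, j', hj', ?_⟩
    rw [← e, ← mul_assoc ((u * v) ^ (-z)), ← hflip]
    simp only [mul_assoc]
    rw [← mul_assoc u u, hu, one_mul]
  have hv_mul : ∀ p ∈ P, ∀ z : ℤ, ∀ j < 2, ∃ p' ∈ P, ∃ z' : ℤ, ∃ j' < 2,
      v * (p * ((u * v) ^ z * u ^ j)) = p' * ((u * v) ^ z' * u ^ j') := by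
    intro p hp z j hj
    obtain ⟨j', hj', e⟩ := hus j hj
    refine ⟨_, hPv p hp, -(1 + z), j', hj', ?_⟩
    rw [← e, ← mul_assoc ((u * v) ^ (-(1 + z))), ← hflip, zpow_add, zpow_one]
    simp only [mul_assoc]
    rw [← mul_assoc u u, hu, one_mul, ← mul_assoc v v, hv, one_mul]
  have key : ∃ p ∈ P, ∃ z : ℤ, ∃ j < 2, h = p * ((u * v) ^ z * u ^ j) := by
    induction hh using Subgroup.closure_induction_left with
    | one => exact ⟨1, one_mem P, 0, 0, by norm_num, by simp⟩
    | mul_left g hg h _ ih =>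
      obtain ⟨p, hp, z, j, hj, rfl⟩ := ih
      rcases hg with hg | rfl | rfl
      · exact ⟨g * p, mul_mem hg hp, z, j, hj, (mul_assoc _ _ _).symm⟩
      · exact hu_mul p hp z j hj
      · exact hv_mul p hp z j hj
    | inv_mul_cancel g hg h _ ih =>
      obtain ⟨p, hp, z, j, hj, rfl⟩ := ih
      rcases hg with hg | rfl | rfl
      · exact ⟨g⁻¹ * p, mul_mem (inv_mem hg) hp, z, j, hj, (mul_assoc _ _ _).symm⟩
      · rw [hui]; exact hu_mul p hp z j hj
      · rw [hvi]; exact hv_mul p hp z j hj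
  obtain ⟨p, hp, z, j, hj, rfl⟩ := key
  have hk' : (0 : ℤ) < k := by exact_mod_cast hk
  refine ⟨p * ((u * v) ^ k) ^ (z / k), mul_mem hp (zpow_mem huv _), (z % k).toNat, ?_, j, hj, ?_⟩
  · have := Int.emod_lt_of_pos z hk'
    have := Int.emod_nonneg z hk'.ne'
    omega
  · have e : (u * v) ^ (z % k).toNat = (u * v) ^ (z % k) := by
      rw [← zpow_natCast, Int.toNat_of_nonneg (Int.emod_nonneg z hk'.ne')]
    rw [e, mul_assoc p, ← zpow_natCast (u * v) k, ← zpow_mul,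
      ← mul_assoc ((u * v) ^ ((k : ℤ) * (z / k))), ← zpow_add,
      Int.mul_ediv_add_emod]

/-- A group generated by four involutions `x, y, u, v`, of which the last two normalize the
dihedral group `⟨x, y⟩`: `(xy)ᵐ = 1`, the conjugates `uxu, uyu, vxv, vyv` and the power `(uv)ᵏ` are
inverse to given words in `x` and `y`. The list `more` contains further states which represent
elements of the group, with words in the generators for their inverses. Groups which need
fewer generators are described with `x = y` and `m = 1`. -/
structure VertexData where
  x : State
  y : State
  u : State
  v : State
  m : ℕ
  k : ℕ
  uxu : List State
  uyu : List State
  vxv : List State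
  vyv : List State
  uvk : List State
  more : List (State × List State)

namespace VertexData

open State StateWord

/-- The word `(st)ⁿ`. -/
def power (s t : State) (n : ℕ) : List State := (List.replicate n [s, t]).flatten

/-- Verifies the relations stated by the data with the help of the automaton. -/
def valid (d : VertexData) : Bool :=
  isTrivial (power d.x d.y d.m) && isTrivial (power d.u d.v d.k ++ d.uvk) &&
  isTrivial (d.u :: d.x :: d.u :: d.uxu) && isTrivial (d.u :: d.y :: d.u :: d.uyu) &&
  isTrivial (d.v :: d.x :: d.v :: d.vxv) && isTrivial (d.v :: d.y :: d.v :: d.vyv) &&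
  ((d.uxu ++ d.uyu ++ d.vxv ++ d.vyv ++ d.uvk).all fun s => s == d.x || s == d.y) &&
  (d.more.all fun p => isTrivial (p.1 :: p.2) &&
    p.2.all fun s => s == d.x || s == d.y || s == d.u || s == d.v) &&
  decide (0 < d.m) && decide (0 < d.k)

/-- The words `(xy)ⁱ xʲ (uv)ᵖ u^q` which represent all elements of the group. -/
def normalWords (d : VertexData) : List (List State) :=
  (List.range d.m).flatMap fun i => (List.range 2).flatMap fun j =>
    (List.range d.k).flatMap fun p => (List.range 2).map fun q =>
      power d.x d.y i ++ List.replicate j d.x ++ (power d.u d.v p ++ List.replicate q d.u)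

/-- The states listed as elements of the group. -/
def states (d : VertexData) : List State := d.x :: d.y :: d.u :: d.v :: d.more.map Prod.fst

/-- The subgroup of `Γ` generated by the four involutions. -/
def group (d : VertexData) : Subgroup Γ :=
  Subgroup.closure {Γ.ofState d.x, Γ.ofState d.y, Γ.ofState d.u, Γ.ofState d.v}

theorem eval_power (s t : State) (n : ℕ) : eval (power s t n) = (Γ.ofState s * Γ.ofState t) ^ n := by
  induction n with
  | zero => rfl
  | succ n ih =>
    have : power s t (n + 1) = [s, t] ++ power s t n := by
      simp [power, List.replicate_succ]
    rw [this, eval_append, ih, pow_succ']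
    simp [eval]

theorem eval_replicate (s : State) (n : ℕ) : eval (List.replicate n s) = Γ.ofState s ^ n := by
  simp [eval]

theorem eval_mem {P : Subgroup Γ} {w : List State} (h : ∀ s ∈ w, Γ.ofState s ∈ P) : eval w ∈ P :=
  P.list_prod_mem (by simpa using h)

/-- The normal words represent all elements of the group. -/
theorem eval_normal_mem {d : VertexData} (hd : d.valid = true) {g : Γ} (hg : g ∈ d.group) :
    ∃ w ∈ d.normalWords, eval w = g := by
  simp only [valid, Bool.and_eq_true, List.all_eq_true, List.mem_append, Bool.or_eq_true,
    beq_iff_eq, decide_eq_true_eq] at hd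
  obtain ⟨⟨⟨⟨⟨⟨⟨⟨⟨hxy, huv⟩, hux⟩, huy⟩, hvx⟩, hvy⟩, hw⟩, -⟩, hm⟩, hk⟩ := hd
  set P : Subgroup Γ := Subgroup.closure {Γ.ofState d.x, Γ.ofState d.y} with hP
  have hPw : ∀ w : List State, (∀ s ∈ w, s = d.x ∨ s = d.y) → eval w ∈ P := fun w h => by
    refine eval_mem fun s hs => Subgroup.subset_closure ?_
    rcases h s hs with rfl | rfl <;> simp
  have hinv : ∀ (w w' : List State), isTrivial (w ++ w') = true → (∀ s ∈ w', s = d.x ∨ s = d.y) →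
      eval w ∈ P := fun w w' h h' => by
    have h1 := eval_eq_one_of_isTrivial h
    rw [eval_append] at h1
    rw [eq_inv_of_mul_eq_one_left h1]
    exact inv_mem (hPw _ h')
  have hconj : ∀ s : State, eval [s, d.x, s] ∈ P → eval [s, d.y, s] ∈ P →
      ∀ p ∈ P, Γ.ofState s * p * Γ.ofState s ∈ P := by
    intro s hx hy p hp
    have hsi := ofState_inv s
    have hle : P ≤ P.comap (MulAut.conj (Γ.ofState s)).toMonoidHom := by
      rw [hP, Subgroup.closure_le]
      rintro _ (rfl | rfl)
      · simpa [eval, hsi, mul_assoc] using hx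
      · simpa [eval, hsi, mul_assoc] using hy
    simpa [hsi] using hle hp
  have hPu := hconj d.u (hinv [d.u, d.x, d.u] d.uxu hux fun s hs => hw s (by simp only [hs, true_or]))
    (hinv [d.u, d.y, d.u] d.uyu huy fun s hs => hw s (by simp only [hs, true_or, or_true]))
  have hPv := hconj d.v (hinv [d.v, d.x, d.v] d.vxv hvx fun s hs => hw s (by simp only [hs, true_or, or_true]))
    (hinv [d.v, d.y, d.v] d.vyv hvy fun s hs => hw s (by simp only [hs, true_or, or_true]))
  have huvk := hinv (power d.u d.v d.k) d.uvk huv fun s hs => hw s (by simp only [hs, or_true])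
  rw [eval_power] at huvk
  have hg' : g ∈ Subgroup.closure (P ∪ {Γ.ofState d.u, Γ.ofState d.v} : Set Γ) := by
    refine Subgroup.closure_mono ?_ hg
    rintro _ (rfl | rfl | rfl | rfl)
    · exact Or.inl (Subgroup.subset_closure (by simp))
    · exact Or.inl (Subgroup.subset_closure (by simp))
    · exact Or.inr (by simp)
    · exact Or.inr (by simp)
  -- The normal form is applied to `P = ⟨x, y⟩` and `u, v`, then to the trivial group and `x, y`.
  obtain ⟨p, hp, i, hi, j, hj, rfl⟩ := exists_normal_form_of_involutions P
    (ofState_mul_self _) (ofState_mul_self _) hPu hPv hk huvk hg'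
  have hp' : p ∈ Subgroup.closure ((⊥ : Subgroup Γ) ∪ {Γ.ofState d.x, Γ.ofState d.y} : Set Γ) :=
    Subgroup.closure_mono Set.subset_union_right hp
  obtain ⟨e, he, i', hi', j', hj', rfl⟩ := exists_normal_form_of_involutions ⊥
    (ofState_mul_self d.x) (ofState_mul_self d.y)
    (fun p hp => by rw [Subgroup.mem_bot.1 hp, mul_one, ofState_mul_self]; exact one_mem _)
    (fun p hp => by rw [Subgroup.mem_bot.1 hp, mul_one, ofState_mul_self]; exact one_mem _)
    hm (Subgroup.mem_bot.2 (by rw [← eval_power]; exact eval_eq_one_of_isTrivial hxy)) hp'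
  refine ⟨power d.x d.y i' ++ List.replicate j' d.x ++ (power d.u d.v i ++ List.replicate j d.u),
    ?_, ?_⟩
  · simp only [normalWords, List.mem_flatMap, List.mem_map, List.mem_range]
    exact ⟨i', hi', j', hj', i, hi, j, hj, rfl⟩
  · rw [Subgroup.mem_bot.1 he, one_mul]
    simp only [eval_append, eval_power, eval_replicate]

theorem ofState_mem {d : VertexData} (hd : d.valid = true) {s : State} (hs : s ∈ d.states) :
    Γ.ofState s ∈ d.group := by
  simp only [valid, Bool.and_eq_true, List.all_eq_true, Bool.or_eq_true, beq_iff_eq] at hd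
  obtain ⟨⟨⟨-, hd⟩, -⟩, -⟩ := hd
  have hgen : ∀ s, ((s = d.x ∨ s = d.y) ∨ s = d.u) ∨ s = d.v → Γ.ofState s ∈ d.group := by
    rintro s (((rfl | rfl) | rfl) | rfl) <;> exact Subgroup.subset_closure (by simp)
  simp only [states, List.mem_cons, List.mem_map] at hs
  rcases hs with h | h | h | h | ⟨p, hp, rfl⟩
  · exact hgen _ (by tauto)
  · exact hgen _ (by tauto)
  · exact hgen _ (by tauto)
  · exact hgen _ (by tauto)
  · have h1 := eval_eq_one_of_isTrivial (hd p hp).1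
    rw [eval_cons] at h1
    rw [eq_inv_of_mul_eq_one_left h1]
    exact inv_mem (eval_mem fun s hs => hgen s ((hd p hp).2 s hs))

end VertexData

open State in
/-- The six groups `Γ_{B₁}, Γ_{A₁}, Γ_{C₁}, Γ_B, Γ_C, Γ_A`, of orders `8, 16, 16, 32, 128, 128`. -/
def vertexData : Fin 6 → VertexData := ![
  ⟨β, β, a, cγ, 1, 2, [β], [β], [β], [β], [], []⟩,
  ⟨α, α, b, c, 1, 4, [α], [α], [α], [α], [], [(αc, [c, α])]⟩,
  ⟨γ, γ, aα, bβ, 1, 4, [γ], [γ], [γ], [γ], [], [(aαγ, [γ, aα])]⟩,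
  ⟨α, γ, a, c, 4, 2, [α], [α, γ, α], [α], [γ], [γ, α, γ, α],
    [(aα, [α, a]), (cγ, [c, γ]), (aαγ, [γ, α, a]), (αc, [c, α])]⟩,
  ⟨α, β, a, b, 8, 4, [α], [β], [α], [β], [β, α, β, α, β, α, β, α], [(aα, [α, a]), (bβ, [b, β])]⟩,
  ⟨β, γ, b, c, 8, 4, [β], [β, γ, β], [γ, β, γ], [γ], [], [(bβ, [b, β]), (cγ, [c, γ])]⟩]

theorem valid_vertexData : ∀ i, (vertexData i).valid = true := by decide +kernel

theorem exists_vertexData {H : Subgroup Γ} (hH : H ∈ vertexGroups) :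
    ∃ i, H = (vertexData i).group := by
  have e1 : Γ.a * Γ.α = Γ.ofState .aα := Subtype.ext State.perm_aα.symm
  have e2 : Γ.b * Γ.β = Γ.ofState .bβ := Subtype.ext State.perm_bβ.symm
  have e3 : Γ.c * Γ.γ = Γ.ofState .cγ := Subtype.ext State.perm_cγ.symm
  simp only [vertexGroups, Set.mem_insert_iff, Set.mem_singleton_iff, e1, e2, e3] at hH
  rcases hH with rfl | rfl | rfl | rfl | rfl | rfl
  · exact ⟨5, rfl⟩
  · exact ⟨3, rfl⟩
  · exact ⟨4, rfl⟩
  · exact ⟨1, congrArg Subgroup.closure (Set.insert_idem _ _).symm⟩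
  · exact ⟨0, congrArg Subgroup.closure (Set.insert_idem _ _).symm⟩
  · exact ⟨2, congrArg Subgroup.closure (Set.insert_idem _ _).symm⟩

namespace StateWord
open VertexData

/-- A pair of words with trivial stabilizer in each of the six groups, such that moreover the
orbits of the pair under these groups intersect only in the orbits under their intersections. -/
def testWords : List (List Letter) := [[2, 0, 0, 3, 0, 0], [3, 0, 3, 2, 0, 2]]

/-- The digits of the words, read as one number in base four. -/
def pack (l : List (List Letter)) : ℕ := l.flatten.foldl (fun n x => 4 * n + x.val) 0

/-- The image of the test words under a word of states, as a number. -/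
def code (w : List State) : ℕ := pack (testWords.map fun p => w.foldr State.act p)

theorem code_congr {v w : List State} (h : eval v = eval w) : code v = code w := by
  have key : ∀ (w : List State) (p : List Letter), w.foldr State.act p = (eval w).1 p := by
    intro w p
    induction w with
    | nil => rfl
    | cons s w ih => rw [List.foldr_cons, ih]; rfl
  simp only [code, key, h]

theorem nodup_code : ∀ i, ((vertexData i).normalWords.map code).Nodup := by decide +kernel

/-- The elements of each of the six groups are determined by their action on the test words. -/
theorem eq_of_code_eq {i : Fin 6} {v w : List State} (hv : eval v ∈ (vertexData i).group)
    (hw : eval w ∈ (vertexData i).group) (h : code v = code w) : eval v = eval w := by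
  obtain ⟨v', hv', ev⟩ := eval_normal_mem (valid_vertexData i) hv
  obtain ⟨w', hw', ew⟩ := eval_normal_mem (valid_vertexData i) hw
  rw [← ev, ← ew, List.inj_on_of_nodup_map (nodup_code i) hv' hw'
    (by rw [code_congr ev, code_congr ew, h])]

/-- The states listed in all three of the given groups. -/
def commonStates (i j k : Fin 6) : List State :=
  (vertexData i).states.filter fun s => (vertexData j).states.elem s && (vertexData k).states.elem s

/-- The alternating words of length at most four in two letters from a list. They represent all
elements of the intersections of different groups, which are dihedral of order at most eight. -/
def alternating (l : List State) : List (List State) :=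
  l.flatMap fun s => l.flatMap fun t => [[], [s], [s, t], [s, t, s], [s, t, s, t]]

/-- Verifies that every element of the `i`-th group which maps the pair of test words into its orbits
under the `j`-th and the `k`-th group acts on this pair as a product of common states. -/
def checkIntersection (i j k : Fin 6) : Bool :=
  (vertexData i).normalWords.all fun w =>
    !((vertexData j).normalWords.map code).elem (code w) ||
    !((vertexData k).normalWords.map code).elem (code w) ||
    w.all (fun s => (commonStates i j k).elem s) ||
    ((alternating (commonStates i j k)).map code).elem (code w)

theorem checkIntersection_eq_true :
    ∀ i j k, i ≤ j → i ≤ k → checkIntersection i j k = true := by decide +kernel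

end StateWord

section

open StateWord VertexData

/-- The triple intersections are generated by states. The choice of `i` as the least index only
shortens the verification, since the orders of the groups do not decrease. -/
theorem mem_closure_commonStates_of_le {i j k : Fin 6} (hij : i ≤ j) (hik : i ≤ k) {g : Γ}
    (hi : g ∈ (vertexData i).group) (hj : g ∈ (vertexData j).group)
    (hk : g ∈ (vertexData k).group) :
    g ∈ Subgroup.closure {g : Γ | ∃ s, Γ.ofState s = g ∧ g ∈ (vertexData i).group ∧
      g ∈ (vertexData j).group ∧ g ∈ (vertexData k).group} := by
  set C : Subgroup Γ := Subgroup.closure {g : Γ | ∃ s, Γ.ofState s = g ∧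
    g ∈ (vertexData i).group ∧ g ∈ (vertexData j).group ∧ g ∈ (vertexData k).group}
  have hcode : ∀ l w, g = eval w → g ∈ (vertexData l).group →
      code w ∈ (vertexData l).normalWords.map code := by
    rintro l w rfl h
    obtain ⟨w', hw', e⟩ := eval_normal_mem (valid_vertexData l) h
    exact List.mem_map.2 ⟨w', hw', code_congr e⟩
  have hcommon : ∀ s ∈ commonStates i j k, Γ.ofState s ∈ (vertexData i).group ∧
      Γ.ofState s ∈ (vertexData j).group ∧ Γ.ofState s ∈ (vertexData k).group := by
    intro s hs
    simp only [commonStates, List.mem_filter, Bool.and_eq_true, List.elem_eq_mem,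
      decide_eq_true_eq] at hs
    exact ⟨ofState_mem (valid_vertexData i) hs.1, ofState_mem (valid_vertexData j) hs.2.1,
      ofState_mem (valid_vertexData k) hs.2.2⟩
  have hC : ∀ w : List State, (∀ s ∈ w, s ∈ commonStates i j k) →
      eval w ∈ C ∧ eval w ∈ (vertexData i).group := fun w hw =>
    ⟨eval_mem fun s hs => Subgroup.subset_closure ⟨s, rfl, hcommon s (hw s hs)⟩,
      eval_mem fun s hs => (hcommon s (hw s hs)).1⟩
  obtain ⟨w, hw, rfl⟩ := eval_normal_mem (valid_vertexData i) hi
  have h := List.all_eq_true.1 (checkIntersection_eq_true i j k hij hik) w hw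
  simp only [Bool.or_eq_true, Bool.not_eq_true', List.elem_eq_mem, decide_eq_false_iff_not,
    List.all_eq_true, decide_eq_true_eq] at h
  rcases h with ((h | h) | h) | h
  · exact absurd (hcode j w rfl hj) h
  · exact absurd (hcode k w rfl hk) h
  · exact (hC w h).1
  · obtain ⟨v, hv, e⟩ := List.mem_map.1 h
    have hv' : ∀ s ∈ v, s ∈ commonStates i j k := by
      simp only [alternating, List.mem_flatMap] at hv
      obtain ⟨s, hs, t, ht, hv⟩ := hv
      simp only [List.mem_cons, List.not_mem_nil, or_false] at hv
      rcases hv with rfl | rfl | rfl | rfl | rfl <;> simp [hs, ht]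
    rw [← eq_of_code_eq (hC v hv').2 hi e]
    exact (hC v hv').1

/-- Every group of the set `𝒢` is generated by states of the automaton. -/
theorem mem_closure_states {G : Subgroup Γ} (hG : G ∈ calG) {g : Γ} (hg : g ∈ G) :
    g ∈ Subgroup.closure {g : Γ | ∃ s, Γ.ofState s = g ∧ g ∈ G} := by
  obtain ⟨H₁, h₁, H₂, h₂, H₃, h₃, rfl⟩ := hG
  obtain ⟨i, rfl⟩ := exists_vertexData h₁
  obtain ⟨j, rfl⟩ := exists_vertexData h₂
  obtain ⟨k, rfl⟩ := exists_vertexData h₃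
  obtain ⟨⟨hi, hj⟩, hk⟩ := hg
  have h : (i ≤ j ∧ i ≤ k) ∨ (j ≤ i ∧ j ≤ k) ∨ (k ≤ i ∧ k ≤ j) := by omega
  rcases h with h | h | h
  · refine Subgroup.closure_mono ?_ (mem_closure_commonStates_of_le h.1 h.2 hi hj hk)
    rintro _ ⟨s, e, h1, h2, h3⟩
    exact ⟨s, e, ⟨h1, h2⟩, h3⟩
  · refine Subgroup.closure_mono ?_ (mem_closure_commonStates_of_le h.1 h.2 hj hi hk)
    rintro _ ⟨s, e, h1, h2, h3⟩
    exact ⟨s, e, ⟨h2, h1⟩, h3⟩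
  · refine Subgroup.closure_mono ?_ (mem_closure_commonStates_of_le h.1 h.2 hk hi hj)
    rintro _ ⟨s, e, h1, h2, h3⟩
    exact ⟨s, e, ⟨h2, h3⟩, h1⟩

end

/-! ### The parity homomorphism -/

/-- All generators are involutions, so that products without inverses exhaust `Γ`. -/
theorem Γ.induction_on {p : Γ → Prop} (g : Γ) (one : p 1)
    (mul : ∀ s ∈ [State.α, .β, .γ, .a, .b, .c], ∀ g, p g → p (Γ.ofState s * g)) : p g := by
  obtain ⟨g, hg⟩ := g
  have hinv : ∀ s : State, s.perm⁻¹ = s.perm := fun s => by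
    rw [inv_eq_iff_mul_eq_one]; exact Equiv.ext (State.act_involutive s)
  have key : ∀ s ∈ [State.α, .β, .γ, .a, .b, .c], ∀ g, ∀ hg : g ∈ GammaSubgroup, p ⟨g, hg⟩ →
      p ⟨s.perm * g, mul_mem s.perm_mem hg⟩ := fun s hs g hg h => mul s hs ⟨g, hg⟩ h
  induction hg using Subgroup.closure_induction_left with
  | one => exact one
  | mul_left x hx y hy ih =>
    rcases hx with rfl | rfl | rfl | rfl | rfl | rfl <;> exact key _ (by simp) y hy ih
  | inv_mul_cancel x hx y hy ih =>
    rcases hx with rfl | rfl | rfl | rfl | rfl | rfl <;> simp only [hinv] <;>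
      exact key _ (by simp) y hy ih

namespace Γ

/-- The block `{1, 2}` or `{3, 4}` of a letter, with values `0` and `1`. -/
def block : Letter → ZMod 2 := ![0, 0, 1, 1]

/-- A homomorphism which takes equal values on the sections of every state at related letters
does so for all elements of `Γ`. -/
theorem apply_sec_eq {p : Γ → ZMod 2} (hp : ∀ g h, p (g * h) = p g + p h)
    {r : Letter → Letter → Prop} (hr : ∀ s x y, r x y → r (State.out s x) (State.out s y))
    (hs : ∀ s x y, r x y → p (ofState (State.next s x)) = p (ofState (State.next s y)))
    (g : Γ) {x y : Letter} (hxy : r x y) : p (g.sec x) = p (g.sec y) := by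
  have : r (g.letter x) (g.letter y) ∧ p (g.sec x) = p (g.sec y) := by
    induction g using Γ.induction_on with
    | one => simp only [(one_letter_sec _).1, (one_letter_sec _).2, hxy, true_and]
    | mul s _ g ih =>
      simp only [(mul_letter_sec _ _ _).1, (mul_letter_sec _ _ _).2, (ofState_letter_sec _ _).1,
        (ofState_letter_sec _ _).2, hp, ih.2, hs s _ _ ih.1]
      exact ⟨hr s _ _ ih.1, True.intro⟩
  exact this.2

/-- Every element of `Γ` preserves or swaps the two blocks. -/
theorem block_letter (g : Γ) (x : Letter) :
    block (g.letter x) = block x + block (g.letter 0) := by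
  have hs : ∀ s x, block (State.out s x) = block x + block (State.out s 0) := by
    intro s; cases s <;> decide
  induction g using Γ.induction_on with
  | one => simp [(one_letter_sec _).1, block]
  | mul s _ g ih =>
    simp only [(mul_letter_sec _ _ _).1, (ofState_letter_sec _ _).1]
    rw [hs s, ih, hs s (g.letter 0)]
    ring

/-- The parity with which `g` permutes the two blocks of letters. -/
noncomputable def parity₁ (g : Γ) : ZMod 2 := block (g.letter 0)

theorem parity₁_mul (g h : Γ) : parity₁ (g * h) = parity₁ g + parity₁ h := by
  simp only [parity₁, (mul_letter_sec _ _ _).1]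
  rw [block_letter, add_comm]

theorem parity₁_ofState (s : State) : parity₁ (ofState s) = block (s.out 0) := by
  rw [parity₁, (ofState_letter_sec _ _).1]

theorem parity₁_sec (g : Γ) {x y : Letter} (h : block x = block y) :
    parity₁ (g.sec x) = parity₁ (g.sec y) := by
  refine apply_sec_eq parity₁_mul (r := fun x y => block x = block y) ?_ ?_ g h
  · intro s; cases s <;> decide
  · simp only [parity₁_ofState]
    intro s; cases s <;> decide

/-- The total parity of the sections at one letter of each block. -/
noncomputable def parity₂ (g : Γ) : ZMod 2 := parity₁ (g.sec 0) + parity₁ (g.sec 2)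

/-- Each element of `Γ` permutes the two blocks, and the parity of a section depends only on the
block of the letter, so the sum over the two blocks is multiplicative. -/
theorem parity₂_mul (g h : Γ) : parity₂ (g * h) = parity₂ g + parity₂ h := by
  have h2 := block_letter h 2
  have hz : ∀ z : Letter, block z = block 0 ∨ block z = block 2 := by decide
  have hz' : (block 0 : ZMod 2) ≠ block 2 := by decide
  simp only [parity₂, (mul_letter_sec _ _ _).2, parity₁_mul]
  rcases hz (h.letter 0) with e | e
  · have e' : block (h.letter 2) = block 2 := by rw [h2, e]; decide
    rw [parity₁_sec g e, parity₁_sec g e']; ring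
  · have e' : block (h.letter 2) = block 0 := by rw [h2, e]; decide
    rw [parity₁_sec g e, parity₁_sec g e']; ring

theorem parity₂_ofState (s : State) :
    parity₂ (ofState s) = block ((s.next 0).out 0) + block ((s.next 2).out 0) := by
  simp only [parity₂, (ofState_letter_sec _ _).2, parity₁_ofState]

theorem parity₂_sec (g : Γ) (x y : Letter) : parity₂ (g.sec x) = parity₂ (g.sec y) := by
  refine apply_sec_eq parity₂_mul (r := fun _ _ => True) (fun _ _ _ _ => True.intro) ?_ g True.intro
  simp only [parity₂_ofState]
  intro s; cases s <;> decide

/-- The parity of the number of factors `a, b, c` in a product of generators: the summands count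
the factors `a`, `b` and `c` respectively. -/
noncomputable def parity (g : Γ) : ZMod 2 := parity₁ g + parity₂ g + parity₂ (g.sec 0)

theorem parity_mul (g h : Γ) : parity (g * h) = parity g + parity h := by
  simp only [parity, parity₁_mul, parity₂_mul, (mul_letter_sec _ _ _).2,
    parity₂_sec g (h.letter 0) 0]
  ring

theorem parity_one : parity 1 = 0 := by simpa using parity_mul 1 1

theorem parity_inv (g : Γ) : parity g⁻¹ = parity g := by
  have h := parity_mul g⁻¹ g
  rw [inv_mul_cancel, parity_one] at h
  rw [← sub_eq_zero, CharTwo.sub_eq_add, ← h]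

end Γ

/-- The parity of a state. -/
def State.parity : State → ZMod 2
  | ε | α | β | γ => 0
  | _ => 1

theorem Γ.parity_ofState (s : State) : parity (ofState s) = s.parity := by
  simp only [parity, parity₁_ofState, parity₂_ofState, (ofState_letter_sec _ _).2]
  cases s <;> decide

open StateWord in
/-- The subgroup `IMG(f)` is the kernel of the parity homomorphism. -/
theorem mem_IMG_iff (g : Γ) : g ∈ IMG ↔ Γ.parity g = 0 := by
  constructor
  · intro hg
    induction hg using Subgroup.closure_induction with
    | mem g hg =>
      rcases hg with rfl | rfl | rfl | rfl | rfl <;>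
        simp only [Γ.α, Γ.β, Γ.γ, Γ.a, Γ.b, Γ.c, Γ.parity_mul, Γ.parity_ofState] <;> decide
    | one => exact Γ.parity_one
    | mul g h _ _ hg hh => rw [Γ.parity_mul, hg, hh, add_zero]
    | inv g _ hg => rw [Γ.parity_inv, hg]
  · have hα : Γ.ofState .α ∈ IMG := Subgroup.subset_closure (by simp [Γ.α])
    have hβ : Γ.ofState .β ∈ IMG := Subgroup.subset_closure (by simp [Γ.β])
    have hγ : Γ.ofState .γ ∈ IMG := Subgroup.subset_closure (by simp [Γ.γ])
    have hac : Γ.ofState .a * Γ.ofState .c ∈ IMG := Subgroup.subset_closure (by simp [Γ.a, Γ.c])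
    have hcb : Γ.ofState .c * Γ.ofState .b ∈ IMG := Subgroup.subset_closure (by simp [Γ.c, Γ.b])
    have hca := inv_mem hac
    have hbc := inv_mem hcb
    rw [mul_inv_rev, ofState_inv, ofState_inv] at hca hbc
    have hab : Γ.ofState .a * Γ.ofState .b ∈ IMG := by
      have := mul_mem hac hcb
      rwa [← mul_assoc, mul_assoc (Γ.ofState .a), ofState_mul_self, mul_one] at this
    have hba := inv_mem hab
    rw [mul_inv_rev, ofState_inv, ofState_inv] at hba
    -- Conjugation by `a` fixes `α` and `β` and maps `γ` to `αγα`.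
    have rα : eval [.a, .α, .a, .α] = 1 := eval_eq_one_of_isTrivial (by decide +kernel)
    have rβ : eval [.a, .β, .a, .β] = 1 := eval_eq_one_of_isTrivial (by decide +kernel)
    have rγ : eval [.a, .γ, .a, .α, .γ, .α] = 1 := eval_eq_one_of_isTrivial (by decide +kernel)
    have heven : ∀ s ∈ [State.α, .β, .γ], Γ.ofState s ∈ IMG ∧
        Γ.ofState .a * Γ.ofState s * Γ.ofState .a ∈ IMG := by
      have aux : ∀ (s : State) (w : List State), eval ([.a, s, .a] ++ w) = 1 → eval w ∈ IMG →
          Γ.ofState .a * Γ.ofState s * Γ.ofState .a ∈ IMG := by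
        intro s w h hw
        rw [eval_append] at h
        have := inv_mem hw
        rw [← eq_inv_of_mul_eq_one_left h] at this
        simpa [eval, mul_assoc] using this
      simp only [List.mem_cons, List.not_mem_nil, or_false, forall_eq_or_imp, forall_eq]
      exact ⟨⟨hα, aux _ _ rα (by simpa [eval] using hα)⟩, ⟨hβ, aux _ _ rβ (by simpa [eval] using hβ)⟩,
        ⟨hγ, aux _ _ rγ (by simpa [eval] using mul_mem hα (mul_mem hγ hα))⟩⟩
    have hodd : ∀ s ∈ [State.a, .b, .c], Γ.ofState s * Γ.ofState .a ∈ IMG ∧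
        Γ.ofState .a * Γ.ofState s ∈ IMG := by
      simp only [List.mem_cons, List.not_mem_nil, or_false, forall_eq_or_imp, forall_eq,
        ofState_mul_self]
      exact ⟨⟨one_mem _, one_mem _⟩, ⟨hba, hab⟩, ⟨hca, hac⟩⟩
    have haa : ∀ g, Γ.ofState .a * (Γ.ofState .a * g) = g := fun g => by
      rw [← mul_assoc, ofState_mul_self, one_mul]
    -- The cosets `IMG(f)` and `a·IMG(f)` exhaust `Γ`.
    have key : (Γ.parity g = 0 → g ∈ IMG) ∧ (Γ.parity g = 1 → Γ.ofState .a * g ∈ IMG) := by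
      induction g using Γ.induction_on with
      | one => exact ⟨fun _ => one_mem _, fun h => absurd (Γ.parity_one.symm.trans h) (by decide)⟩
      | mul s hs g ih =>
        rw [Γ.parity_mul, Γ.parity_ofState]
        have hs' : s ∈ [State.α, .β, .γ] ∨ s ∈ [State.a, .b, .c] := by
          rw [← List.mem_append]; exact hs
        rcases hs' with hs | hs
        · have e : s.parity = 0 := by
            simp only [List.mem_cons, List.not_mem_nil, or_false] at hs
            rcases hs with rfl | rfl | rfl <;> rfl
          rw [e, zero_add]
          refine ⟨fun h => mul_mem (heven s hs).1 (ih.1 h), fun h => ?_⟩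
          have := mul_mem (heven s hs).2 (ih.2 h)
          rwa [mul_assoc, haa, mul_assoc] at this
        · have e : s.parity = 1 := by
            simp only [List.mem_cons, List.not_mem_nil, or_false] at hs
            rcases hs with rfl | rfl | rfl <;> rfl
          rw [e]
          have h01 : ∀ z : ZMod 2, (1 + z = 0 → z = 1) ∧ (1 + z = 1 → z = 0) := by decide
          refine ⟨fun h => ?_, fun h => ?_⟩
          · have := mul_mem (hodd s hs).1 (ih.2 ((h01 _).1 h))
            rwa [mul_assoc, haa] at this
          · have := mul_mem (hodd s hs).2 (ih.1 ((h01 _).2 h))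
            rwa [mul_assoc] at this
    exact key.1

/-! ### Tensor products and words -/

theorem Tensor.tmul_eq_tmul_iff {G : Type} [Group G] {X : Type} [MulAction Gᵐᵒᵖ X]
    {M : PermBimodule G} {ξ ξ' : X} {m m' : M.carrier} :
    (tmul ξ m : Tensor X M) = tmul ξ' m' ↔ ∃ g : G, ξ = ξ' <• g ∧ m' = g • m := by
  constructor
  · intro h
    have key : ∀ p q : X × M.carrier, Relation.EqvGen (TensorRel X M) p q →
        ∃ g : G, p.1 = q.1 <• g ∧ q.2 = g • p.2 := by
      intro p q h
      induction h with
      | rel p q h =>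
        obtain ⟨ξ, g, m⟩ := h
        exact ⟨g, rfl, rfl⟩
      | refl p => exact ⟨1, by simp, by simp⟩
      | symm p q _ ih =>
        obtain ⟨g, h1, h2⟩ := ih
        exact ⟨g⁻¹, by rw [h1, MulOpposite.op_inv, inv_smul_smul], by rw [h2, inv_smul_smul]⟩
      | trans p q r _ _ ih ih' =>
        obtain ⟨g, h1, h2⟩ := ih
        obtain ⟨g', h1', h2'⟩ := ih'
        exact ⟨g' * g, by rw [h1, h1', smul_smul, MulOpposite.op_mul], by rw [h2', h2, smul_smul]⟩
    exact key _ _ (Quot.eqvGen_exact h)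
  · rintro ⟨g, rfl, rfl⟩
    exact smul_tmul ξ' g m

theorem Tensor.tmul_smul {G : Type} [Group G] {X : Type} [MulAction Gᵐᵒᵖ X]
    {M : PermBimodule G} (ξ : X) (m : M.carrier) (g : G) :
    (tmul ξ (m <• g) : Tensor X M) = tmul ξ m <• g := rfl

/-- An element moves past a letter at the cost of replacing it by its section. -/
theorem tmul_smul_letter {n : ℕ} (m : (bimoduleM.pow n).carrier) (k h : Γ) (x : Letter) :
    (Tensor.tmul (M := bimoduleM) (m <• k) (LetterTimesΓ.mk x h) : (bimoduleM.pow (n + 1)).carrier) =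
      (Tensor.tmul (M := bimoduleM) m (LetterTimesΓ.mk (k.letter x) 1) :
        (bimoduleM.pow (n + 1)).carrier) <• (k.sec x * h) := by
  refine (Tensor.smul_tmul (M := bimoduleM) m k (LetterTimesΓ.mk x h)).trans ?_
  change Tensor.tmul (M := bimoduleM) m (LetterTimesΓ.mk (k.letter x) (k.sec x * h)) =
    Tensor.tmul (M := bimoduleM) m (LetterTimesΓ.mk (k.letter x) (1 * (k.sec x * h)))
  rw [one_mul]

theorem wordM_snoc {n : ℕ} (v : Fin n → Letter) (x : Letter) :
    wordM (n + 1) (Fin.snoc (α := fun _ => Letter) v x) =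
      Tensor.tmul (M := bimoduleM) (wordM n v) (LetterTimesΓ.mk x 1) := by
  rw [wordM, Fin.init_snoc, Fin.snoc_last]

/-- An element of a set `S` closed under sections moves past a word and leaves an element of `S`. -/
theorem exists_smul_wordM {S : Set Γ} (hS : ∀ g ∈ S, ∀ x, g.sec x ∈ S) (n : ℕ) {g : Γ}
    (hg : g ∈ S) (v : Fin n → Letter) :
    ∃ u, ∃ k ∈ S, g • wordM n v = wordM n u <• k := by
  induction n with
  | zero => exact ⟨v, g, hg, (mul_one g).trans (one_mul g).symm⟩
  | succ n ih =>
    obtain ⟨u, k, hk, e⟩ := ih (Fin.init v)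
    refine ⟨Fin.snoc (α := fun _ => Letter) u (k.letter (v (Fin.last n))), k.sec (v (Fin.last n)),
      hS k hk _, ?_⟩
    change Tensor.tmul (M := bimoduleM) (g • wordM n (Fin.init v))
      (LetterTimesΓ.mk (v (Fin.last n)) 1) = _
    rw [e, wordM_snoc]
    refine (tmul_smul_letter _ _ _ _).trans ?_
    rw [mul_one]
    rfl

theorem exists_eq_wordM_smul (n : ℕ) (m : (bimoduleM.pow n).carrier) :
    ∃ v, ∃ k : Γ, m = wordM n v <• k := by
  induction n with
  | zero => exact ⟨Fin.elim0, m, (one_mul (M := Γ) m).symm⟩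
  | succ n ih =>
    obtain ⟨m, x, h⟩ := m
    obtain ⟨v, k, rfl⟩ := ih m
    refine ⟨Fin.snoc (α := fun _ => Letter) v (k.letter x), k.sec x * h, ?_⟩
    rw [wordM_snoc]
    exact tmul_smul_letter _ _ _ _

/-- The element `v·g` of `𝔐^{⊗ n}` is regarded as the transformation `w ↦ v g(w)` of finite words,
which is independent of the way the element is written as a tensor. -/
theorem exists_wordM_action (n : ℕ) : ∃ E : (bimoduleM.pow n).carrier → List Letter → List Letter,
    (∀ m (g : Γ) w, E (m <• g) w = E m (g.1 w)) ∧ ∀ v w, E (wordM n v) w = List.ofFn v ++ w := by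
  induction n with
  | zero =>
    exact ⟨fun g w => (show Γ from g).1 w, fun m g w => rfl, fun v w => rfl⟩
  | succ n ih =>
    obtain ⟨E, h1, h2⟩ := ih
    refine ⟨Quot.lift (fun p w => E p.1 ((show LetterTimesΓ from p.2).letter ::
      (show LetterTimesΓ from p.2).elt.1 w)) ?_, ?_, ?_⟩
    · rintro _ _ ⟨m, g, ⟨x, h⟩⟩
      funext w
      refine (h1 _ _ _).trans ?_
      rw [Γ.apply_cons]; rfl
    · rintro ⟨m, x, h⟩ g w
      rfl
    · intro v w
      refine (h2 (Fin.init v) (v (Fin.last n) :: w)).trans ?_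
      rw [List.ofFn_succ', List.concat_eq_append, List.append_assoc]
      rfl

/-- The right action of `Γ` on `𝔐^{⊗ n}` is free and the words lie in different orbits. -/
theorem wordM_smul_inj {n : ℕ} {u v : Fin n → Letter} {g h : Γ}
    (e : wordM n u <• g = wordM n v <• h) : u = v ∧ g = h := by
  obtain ⟨E, h1, h2⟩ := exists_wordM_action n
  have key : ∀ w, List.ofFn u = List.ofFn v ∧ g.1 w = h.1 w := by
    intro w
    have := congrArg (fun m => E m w) e
    simp only [h1, h2] at this
    exact List.append_inj this (by simp)
  exact ⟨List.ofFn_injective (key []).1, Subtype.ext (Equiv.ext fun w => (key w).2)⟩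

/-! ### The fundamental domain `𝒯₀` -/

theorem mem_op_smul {g x : Γ} {S : Set Γ} : x ∈ S <• g ↔ x * g⁻¹ ∈ S := by
  rw [Set.mem_smul_set_iff_inv_smul_mem, ← MulOpposite.op_inv]; rfl

theorem Xi.smul_coord (ξ : Xi) (g : Γ) (S : CosetPoset) :
    (ξ <• g).coord S = ξ.coord ((cosetTranslate (MulOpposite.op g)).symm S) := rfl

theorem Xi.mem_support_smul {ξ : Xi} {g : Γ} {S : CosetPoset} (hS : S ∈ ξ.coord.support) :
    cosetTranslate (MulOpposite.op g) S ∈ (ξ <• g).coord.support := by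
  rw [Finsupp.mem_support_iff, Xi.smul_coord, OrderIso.symm_apply_apply]
  exact Finsupp.mem_support_iff.1 hS

theorem Finset.exists_le_of_isChain {P : Type*} [PartialOrder P] {s : Finset P}
    (hs : IsChain (· ≤ ·) (s : Set P)) (hne : s.Nonempty) : ∃ p ∈ s, ∀ q ∈ s, p ≤ q := by
  obtain ⟨p, hp⟩ := s.exists_minimal hne
  refine ⟨p, hp.1, fun q hq => ?_⟩
  rcases hs.total hp.1 hq with h | h
  · exact h
  · exact hp.2 hq h

theorem Xi.support_nonempty (ξ : Xi) : ξ.coord.support.Nonempty := by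
  rw [Finsupp.support_nonempty_iff]
  intro h
  have := ξ.sum_eq_one
  rw [h, Finsupp.sum_zero_index] at this
  exact zero_ne_one this

theorem exists_mem_of_isChain {s : Finset CosetPoset} (hs : IsChain (· ≤ ·) (s : Set CosetPoset)) :
    ∃ g : Γ, ∀ S ∈ s, g ∈ S.1 := by
  rcases s.eq_empty_or_nonempty with rfl | hne
  · exact ⟨1, by simp⟩
  · obtain ⟨⟨_, G, hG, g, rfl⟩, h0, hle⟩ := Finset.exists_le_of_isChain hs hne
    refine ⟨g, fun S hS => hle S hS ?_⟩
    exact mem_op_smul.2 (by rw [mul_inv_cancel]; exact G.one_mem)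

/-- An element common to all vertices of a simplex moves this simplex into `𝒯₀`. -/
theorem smul_inv_mem_T₀ {ξ : Xi} {g : Γ} (h : ∀ S ∈ ξ.coord.support, g ∈ S.1) :
    ξ <• g⁻¹ ∈ T₀ := by
  intro S hS
  rw [Finsupp.mem_support_iff, Xi.smul_coord] at hS
  have h1 := h _ (Finsupp.mem_support_iff.2 hS)
  have h2 : g ∈ (MulOpposite.op g⁻¹)⁻¹ • S.1 := h1
  rw [Set.mem_inv_smul_set_iff] at h2
  simpa using h2

/-- The vertices of `𝒯₀` are the groups of `𝒢`. -/
theorem CosetPoset.exists_eq_of_one_mem {S : CosetPoset} (h : (1 : Γ) ∈ S.1) :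
    ∃ G ∈ calG, S.1 = (G : Set Γ) := by
  obtain ⟨_, G, hG, g, rfl⟩ := S
  refine ⟨G, hG, ?_⟩
  have hg : g⁻¹ ∈ G := by simpa using mem_op_smul.1 h
  ext x
  rw [mem_op_smul]
  exact G.mul_mem_cancel_right hg

/-- `𝒯₀` is a strict fundamental domain: an element which maps a point of `𝒯₀` into `𝒯₀` lies in a
group of `𝒢` which fixes this point. -/
theorem exists_calG_of_smul_mem_T₀ {ξ : Xi} {h : Γ} (hξ : ξ ∈ T₀) (hξh : ξ <• h ∈ T₀) :
    ∃ G ∈ calG, h ∈ G ∧ ∀ k ∈ G, ξ <• k = ξ := by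
  obtain ⟨S₀, hS₀, hle⟩ := Finset.exists_le_of_isChain ξ.isChain ξ.support_nonempty
  obtain ⟨G, hG, e⟩ := CosetPoset.exists_eq_of_one_mem (hξ S₀ hS₀)
  refine ⟨G, hG, ?_, fun k hk => ?_⟩
  · have h1 : (1 : Γ) ∈ S₀.1 <• h := hξh _ (Xi.mem_support_smul hS₀)
    rw [mem_op_smul, one_mul, e] at h1
    exact inv_mem_iff.1 h1
  · have hfix : ∀ S ∈ ξ.coord.support, cosetTranslate (MulOpposite.op k) S = S := by
      intro S hS
      obtain ⟨G', -, e'⟩ := CosetPoset.exists_eq_of_one_mem (hξ S hS)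
      have hk' : k ∈ G' := by
        have : k ∈ S.1 := hle S hS (by rw [e]; exact hk)
        rwa [e'] at this
      apply Subtype.ext
      change S.1 <• k = S.1
      rw [e']
      ext x
      rw [mem_op_smul]
      exact G'.mul_mem_cancel_right (inv_mem hk')
    apply OrderComplex.ext
    ext S
    rw [Xi.smul_coord]
    set S' := (cosetTranslate (MulOpposite.op k)).symm S with hS'
    have e1 : cosetTranslate (MulOpposite.op k) S' = S := OrderIso.apply_symm_apply _ _
    by_cases h' : S' ∈ ξ.coord.support
    · rw [← e1, hfix S' h']
    · by_cases h'' : S ∈ ξ.coord.support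
      · have : S' = S := by rw [hS', OrderIso.symm_apply_eq, hfix S h'']
        rw [this]
      · rw [Finsupp.notMem_support_iff.1 h', Finsupp.notMem_support_iff.1 h'']

/-! ### Pasting -/

/-- The point `ξ ⊗ v` of `𝒯ₙ`. -/
noncomputable def T.point {n : ℕ} {ξ : Xi} (hξ : ξ ∈ T₀) (v : Fin n → Letter) : T n :=
  ⟨Tensor.tmul ξ (wordM n v), ξ, hξ, v, rfl⟩

/-- The point `x·aⁱ` of the disjoint union of the copies `𝒯ₙ` and `𝒯ₙ·a`. -/
noncomputable def copy {n : ℕ} (i : ZMod 2) (x : T n) : T n ⊕ (T n <• Γ.a : Set (XiN n)) :=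
  if i = 0 then .inl x else .inr ⟨x.1 <• Γ.a, Set.smul_mem_smul_set x.2⟩

theorem exists_eq_copy {n : ℕ} (y : T n ⊕ (T n <• Γ.a : Set (XiN n))) : ∃ i x, y = copy i x := by
  rcases y with x | ⟨_, x, hx, rfl⟩
  · exact ⟨0, x, (if_pos rfl).symm⟩
  · exact ⟨1, ⟨x, hx⟩, (if_neg (by decide)).symm⟩

theorem ofState_mem_crossElements {s : State} (h : s.parity = 1) : Γ.ofState s ∈ crossElements := by
  have e1 : Γ.ofState .aα = Γ.a * Γ.α := Subtype.ext State.perm_aα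
  have e2 : Γ.ofState .bβ = Γ.b * Γ.β := Subtype.ext State.perm_bβ
  have e3 : Γ.ofState .cγ = Γ.c * Γ.γ := Subtype.ext State.perm_cγ
  have e4 : Γ.ofState .aαγ = Γ.ofState .aα * Γ.γ := by rw [e1]; exact Subtype.ext State.perm_aαγ
  have e5 : Γ.ofState .αc = Γ.α * Γ.c := Subtype.ext State.perm_αc
  simp only [crossElements, ← e1, ← e2, ← e3, ← e4, ← e5]
  cases s <;> first | exact absurd h (by decide) | simp [Γ.a, Γ.b, Γ.c]

theorem ofState_mem_selfElements {s : State} (h : s.parity = 0) (hs : s ≠ .ε) :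
    Γ.ofState s ∈ selfElements := by
  cases s <;> first
    | exact absurd h (by decide)
    | exact absurd rfl hs
    | simp [selfElements, Γ.α, Γ.β, Γ.γ]

theorem ZMod.eq_zero_or_eq_one (i : ZMod 2) : i = 0 ∨ i = 1 := by
  revert i; decide

/-- Points of `𝒯ₙ` which differ by a state are identified by a pasting rule, in the same copy or in
different copies according to the parity of the state. -/
theorem mk_copy_ofState {n : ℕ} {x y : T n} {s : State} (h : x.1 <• Γ.ofState s = y.1)
    (i : ZMod 2) : Pasted.mk (copy i x) = Pasted.mk (copy (i + s.parity) y) := by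
  have hsi := StateWord.ofState_inv s
  have h' : y.1 <• Γ.ofState s = x.1 := by
    rw [← h, smul_smul, ← MulOpposite.op_mul, StateWord.ofState_mul_self, MulOpposite.op_one,
      one_smul]
  have hK : ∀ {x y : T n}, y.1 <• Γ.ofState s = x.1 → x.1 ∈ K (Γ.ofState s) n :=
    fun {x y} h => ⟨x.2, y.1, y.2, h⟩
  have hkappa : ∀ {x y : T n} (h : x.1 <• Γ.ofState s = y.1) (h' : y.1 <• Γ.ofState s = x.1),
      (kappa (Γ.ofState s) n ⟨x.1, hK h'⟩).1 = y.1 := fun {x y} h h' => by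
    change x.1 <• (Γ.ofState s)⁻¹ = y.1
    rw [hsi, h]
  have cross : s.parity = 1 → ∀ {x y : T n}, x.1 <• Γ.ofState s = y.1 →
      y.1 <• Γ.ofState s = x.1 → Pasted.mk (.inl x) = Pasted.mk (copy 1 y) := by
    intro hs x y h h'
    refine (Quot.sound (.cross _ (ofState_mem_crossElements hs) ⟨x.1, hK h'⟩)).trans ?_
    refine congrArg Pasted.mk (Eq.trans ?_ (if_neg (by decide)).symm)
    exact congrArg Sum.inr (Subtype.ext (congrArg (· <• Γ.a) (hkappa h h')))
  rcases ZMod.eq_zero_or_eq_one s.parity with hs | hs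
  · rw [hs, add_zero]
    by_cases hε : s = .ε
    · rw [hε, StateWord.ofState_ε, MulOpposite.op_one, one_smul] at h
      rw [Subtype.ext h]
    · unfold copy
      split_ifs
      · refine (Quot.sound (.self_left _ (ofState_mem_selfElements hs hε) ⟨x.1, hK h'⟩)).trans ?_
        exact congrArg (fun z => Pasted.mk (.inl z)) (Subtype.ext (hkappa h h'))
      · refine (Quot.sound (.self_right _ (ofState_mem_selfElements hs hε) ⟨x.1, hK h'⟩)).trans ?_
        exact congrArg (fun z => Pasted.mk (.inr z))
          (Subtype.ext (congrArg (· <• Γ.a) (hkappa h h')))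
  · rw [hs]
    rcases ZMod.eq_zero_or_eq_one i with rfl | rfl
    · exact cross hs h h'
    · exact (cross hs h' h).symm

/-- An element `h` of a group of `𝒢` which fixes `ξ` carries `ξ ⊗ v` to a point which is joined to
`ξ ⊗ v` by pasting maps: `h` is a product of states which fix `ξ`, and the sections of the states
are states. -/
theorem exists_mk_copy_point {n : ℕ} {ξ : Xi} (hξ : ξ ∈ T₀) {G : Subgroup Γ} (hG : G ∈ calG)
    (hfix : ∀ k ∈ G, ξ <• k = ξ) {h : Γ} (hh : h ∈ G) (v : Fin n → Letter) :
    ∃ u k, h • wordM n v = wordM n u <• k ∧ ∀ i,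
      Pasted.mk (copy i (T.point hξ v)) = Pasted.mk (copy (i + Γ.parity k) (T.point hξ u)) := by
  have step : ∀ s, Γ.ofState s ∈ G → ∀ v : Fin n → Letter, ∃ u k,
      Γ.ofState s • wordM n v = wordM n u <• k ∧ ∀ i, Pasted.mk (copy i (T.point hξ v)) =
        Pasted.mk (copy (i + Γ.parity k) (T.point hξ u)) := by
    intro s hs v
    obtain ⟨u, _, ⟨t, rfl⟩, e⟩ := exists_smul_wordM (S := Set.range Γ.ofState)
      (by rintro _ ⟨s, rfl⟩ x; exact ⟨_, (Γ.ofState_letter_sec s x).2.symm⟩) n ⟨s, rfl⟩ v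
    refine ⟨u, Γ.ofState t, e, fun i => ?_⟩
    rw [Γ.parity_ofState]
    refine mk_copy_ofState ?_ i
    change (Tensor.tmul ξ (wordM n v) : XiN n) <• Γ.ofState t = Tensor.tmul ξ (wordM n u)
    conv_lhs => rw [← hfix _ hs, Tensor.smul_tmul, e, ← Tensor.tmul_smul, smul_smul,
      ← MulOpposite.op_mul, StateWord.ofState_mul_self, MulOpposite.op_one, one_smul]
  replace hh := mem_closure_states hG hh
  have comp : ∀ s, Γ.ofState s ∈ G → ∀ g, (∃ u k, g • wordM n v = wordM n u <• k ∧ ∀ i,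
      Pasted.mk (copy i (T.point hξ v)) = Pasted.mk (copy (i + Γ.parity k) (T.point hξ u))) →
      ∃ u k, (Γ.ofState s * g) • wordM n v = wordM n u <• k ∧ ∀ i,
      Pasted.mk (copy i (T.point hξ v)) = Pasted.mk (copy (i + Γ.parity k) (T.point hξ u)) := by
    rintro s hs g ⟨u, k, e, hk⟩
    obtain ⟨u', k', e', hk'⟩ := step s hs u
    refine ⟨u', k' * k, ?_, fun i => ?_⟩
    · rw [mul_smul, e, smul_comm, e', smul_smul, MulOpposite.op_mul]
    · rw [hk, hk', Γ.parity_mul, add_assoc, add_comm (Γ.parity k)]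
  induction hh using Subgroup.closure_induction_left with
  | one => exact ⟨v, 1, by simp, fun i => by rw [Γ.parity_one, add_zero]⟩
  | mul_left x hx g _ ih =>
    obtain ⟨s, rfl, hs⟩ := hx
    exact comp s hs g ih
  | inv_mul_cancel x hx g _ ih =>
    obtain ⟨s, rfl, hs⟩ := hx
    rw [StateWord.ofState_inv]
    exact comp s hs g ih

/-- Points of `𝒯ₙ` in one `Γ`-orbit are joined by pasting maps, and the parity of the element which
carries one point to the other determines the copies. -/
theorem mk_copy_smul {n : ℕ} {x y : T n} {g : Γ} (h : x.1 <• g = y.1) (i : ZMod 2) :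
    Pasted.mk (copy i x) = Pasted.mk (copy (i + Γ.parity g) y) := by
  obtain ⟨_, ξ, hξ, v, rfl⟩ := x
  obtain ⟨_, η, hη, u, rfl⟩ := y
  change (Tensor.tmul ξ (wordM n v <• g) : XiN n) = Tensor.tmul η (wordM n u) at h
  obtain ⟨k, rfl, e⟩ := Tensor.tmul_eq_tmul_iff.1 h
  obtain ⟨G, hG, hk, hfix⟩ := exists_calG_of_smul_mem_T₀ hη hξ
  obtain ⟨u', l, e', hl⟩ := exists_mk_copy_point hη hG hfix hk v
  rw [smul_comm, e', smul_smul, ← MulOpposite.op_mul] at e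
  have e1 : wordM n u <• (1 : Γ) = wordM n u' <• (l * g) := by
    rw [MulOpposite.op_one, one_smul]; exact e
  -- The section `l` of `k` along `v` is the inverse of `g`.
  obtain ⟨rfl, h1⟩ := wordM_smul_inj e1
  have h2 : Γ.parity g = Γ.parity l := by
    rw [eq_inv_of_mul_eq_one_right h1.symm, Γ.parity_inv]
  rw [h2]
  have h3 := hl i
  have h4 : (⟨Tensor.tmul (η <• k) (wordM n v), η <• k, hξ, v, rfl⟩ : T n) = T.point hη v :=
    Subtype.ext (congrArg (fun ζ => (Tensor.tmul ζ (wordM n v) : XiN n)) (hfix k hk))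
  rw [h4, h3]; rfl

/-! ### Topology -/

/-- The Euclidean topology of a closed simplex, as opposed to the subspace topology. -/
@[reducible]
def OrderComplex.faceTopology {P : Type} [PartialOrder P] (s : Finset P) :
    TopologicalSpace (OrderComplex.face s) :=
  TopologicalSpace.induced (fun (x : OrderComplex.face s) (p : s) => x.1.coord p.1) inferInstance

theorem OrderComplex.continuous_subtype_val_face {P : Type} [PartialOrder P] {s : Finset P}
    (hs : IsChain (· ≤ ·) (s : Set P)) :
    @Continuous _ _ (OrderComplex.faceTopology s) _ (Subtype.val : OrderComplex.face s → _) := by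
  rw [continuous_iff_coinduced_le]
  exact le_iSup (fun s : {s : Finset P // IsChain (· ≤ ·) (s : Set P)} =>
    TopologicalSpace.coinduced (Subtype.val : OrderComplex.face s.1 → OrderComplex P)
      (OrderComplex.faceTopology s.1)) ⟨s, hs⟩

theorem OrderComplex.isOpen_iff {P : Type} [PartialOrder P] {U : Set (OrderComplex P)} :
    IsOpen U ↔ ∀ s : Finset P, IsChain (· ≤ ·) (s : Set P) →
      @IsOpen _ (OrderComplex.faceTopology s) (Subtype.val ⁻¹' U : Set (OrderComplex.face s)) := by
  refine isOpen_iSup_iff.trans ⟨fun h s hs => h ⟨s, hs⟩, fun h s => h s.1 s.2⟩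

theorem OrderComplex.continuous_map {P Q : Type} [PartialOrder P] [PartialOrder Q] (e : P ≃o Q) :
    Continuous (OrderComplex.map e) := by
  refine continuous_def.2 fun U hU => OrderComplex.isOpen_iff.2 fun s hs => ?_
  have hs' : IsChain (· ≤ ·) (s.map e.toEquiv.toEmbedding : Set Q) := by
    rw [Finset.coe_map]
    rintro _ ⟨p, hp, rfl⟩ _ ⟨q, hq, rfl⟩ hpq
    have := hs hp hq (fun h => hpq (by rw [h]))
    simpa using this
  have hmaps : ∀ x : OrderComplex.face s,
      OrderComplex.map e x.1 ∈ OrderComplex.face (s.map e.toEquiv.toEmbedding) := by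
    intro x q hq
    have hq' : e.symm q ∈ x.1.coord.support := by
      simpa [OrderComplex.map] using hq
    exact Finset.mem_map.2 ⟨e.symm q, x.2 hq', by simp⟩
  have hcont : @Continuous _ _ (OrderComplex.faceTopology s)
      (OrderComplex.faceTopology (s.map e.toEquiv.toEmbedding))
      (fun x : OrderComplex.face s => ⟨OrderComplex.map e x.1, hmaps x⟩) := by
    let _ := OrderComplex.faceTopology s
    refine continuous_induced_rng.2 (continuous_pi fun q => ?_)
    have hq : e.symm q.1 ∈ s := by
      obtain ⟨p, hp, h⟩ := Finset.mem_map.1 q.2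
      rw [← h]; simpa using hp
    exact (continuous_apply (⟨e.symm q.1, hq⟩ : s)).comp (continuous_induced_dom
      (f := fun (x : OrderComplex.face s) (p : s) => x.1.coord p.1))
  have := (OrderComplex.isOpen_iff.1 hU) _ hs'
  exact @IsOpen.preimage _ _ (OrderComplex.faceTopology s) (OrderComplex.faceTopology _) _ hcont _ this

theorem continuous_Xi_smul (g : Γ) : Continuous fun ξ : Xi => ξ <• g :=
  OrderComplex.continuous_map _

theorem continuous_tmul {n : ℕ} (m : (bimoduleM.pow n).carrier) :
    Continuous fun ξ : Xi => (Tensor.tmul ξ m : XiN n) :=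
  continuous_quot_mk.comp (by fun_prop : Continuous fun ξ : Xi => (ξ, m))

theorem isOpen_XiN_iff {n : ℕ} {U : Set (XiN n)} :
    IsOpen U ↔ ∀ m, IsOpen {ξ : Xi | (Tensor.tmul ξ m : XiN n) ∈ U} := by
  refine ⟨fun h m => h.preimage (continuous_tmul m), fun h => ?_⟩
  have : DiscreteTopology (bimoduleM.pow n).carrier := ⟨rfl⟩
  change IsOpen {p : Xi × (bimoduleM.pow n).carrier | (Tensor.tmul p.1 p.2 : XiN n) ∈ U}
  rw [← continuous_Prop, continuous_prod_of_discrete_right]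
  exact fun m => continuous_Prop.2 (h m)

/-- The map from the disjoint union of the two copies to `ℳₙ` which sends every point to its orbit. -/
noncomputable def toOrbit {n : ℕ} : T n ⊕ (T n <• Γ.a : Set (XiN n)) → MN n :=
  Sum.elim (fun x => MN.mk x.1) (fun y => MN.mk y.1)

theorem MN.mk_eq_mk_iff {n : ℕ} {ξ η : XiN n} :
    MN.mk ξ = MN.mk η ↔ ∃ g : Γ, Γ.parity g = 0 ∧ ξ <• g = η := by
  rw [MN.mk, MN.mk, Quotient.eq, MulAction.orbitRel_apply, ← MulAction.orbitRel_apply]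
  constructor
  · intro h
    obtain ⟨g, hg⟩ := MulAction.mem_orbit_iff.1 (MulAction.mem_orbit_symm.1 h)
    exact ⟨g.1.unop, (mem_IMG_iff _).1 g.2, hg⟩
  · rintro ⟨g, hg, rfl⟩
    refine MulAction.mem_orbit_symm.1 (MulAction.mem_orbit_iff.2 ?_)
    exact ⟨⟨MulOpposite.op g, (mem_IMG_iff g).2 hg⟩, rfl⟩

theorem Γ.parity_a : parity a = 1 := parity_ofState .a

/-- The element `aⁱ`. -/
noncomputable def aPow (i : ZMod 2) : Γ := if i = 0 then 1 else Γ.a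

theorem parity_aPow (i : ZMod 2) : Γ.parity (aPow i) = i := by
  rcases ZMod.eq_zero_or_eq_one i with rfl | rfl
  · exact Γ.parity_one
  · exact Γ.parity_a

theorem toOrbit_copy {n : ℕ} (i : ZMod 2) (x : T n) :
    toOrbit (copy i x) = MN.mk (x.1 <• aPow i) := by
  unfold copy aPow
  split_ifs
  · rw [MulOpposite.op_one, one_smul]; rfl
  · rfl

/-- The pasting rules generate the orbit relation. -/
theorem mk_eq_mk_of_toOrbit_eq {n : ℕ} {y z : T n ⊕ (T n <• Γ.a : Set (XiN n))}
    (h : toOrbit y = toOrbit z) : Pasted.mk y = Pasted.mk z := by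
  obtain ⟨i, x, rfl⟩ := exists_eq_copy y
  obtain ⟨j, x', rfl⟩ := exists_eq_copy z
  rw [toOrbit_copy, toOrbit_copy, MN.mk_eq_mk_iff] at h
  obtain ⟨g, hg, h⟩ := h
  have h1 : x.1 <• (aPow i * g * (aPow j)⁻¹) = x'.1 := by
    rw [MulOpposite.op_mul, mul_smul, MulOpposite.op_mul, mul_smul, h, MulOpposite.op_inv,
      inv_smul_smul]
  rw [mk_copy_smul h1 i, Γ.parity_mul, Γ.parity_mul, Γ.parity_inv, parity_aPow, parity_aPow, hg,
    add_zero, ← add_assoc, CharTwo.add_self_eq_zero, zero_add]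

theorem toOrbit_eq_of_pasteRel {n : ℕ} {y z : T n ⊕ (T n <• Γ.a : Set (XiN n))}
    (h : PasteRel n y z) : toOrbit y = toOrbit z := by
  rcases h with ⟨g, hg, ξ⟩ | ⟨g, hg, ξ⟩ | ⟨g, hg, ξ⟩
  · refine MN.mk_eq_mk_iff.2 ⟨g⁻¹ * Γ.a, ?_, mul_smul _ _ _⟩
    rw [Γ.parity_mul, Γ.parity_inv, Γ.parity_a]
    rcases hg with rfl | rfl | rfl | rfl | rfl | rfl | rfl | rfl <;>
      simp only [Γ.α, Γ.β, Γ.γ, Γ.a, Γ.b, Γ.c, Γ.parity_mul, Γ.parity_ofState] <;> decide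
  all_goals
    have hg' : Γ.parity g = 0 := by
      rcases hg with rfl | rfl | rfl <;> exact Γ.parity_ofState _
  · exact MN.mk_eq_mk_iff.2 ⟨g⁻¹, (Γ.parity_inv g).trans hg', rfl⟩
  · refine MN.mk_eq_mk_iff.2 ⟨Γ.a⁻¹ * g⁻¹ * Γ.a, ?_, ?_⟩
    · simp only [Γ.parity_mul, Γ.parity_inv, hg', Γ.parity_a]; decide
    · change (ξ.1 <• Γ.a) <• (Γ.a⁻¹ * g⁻¹ * Γ.a) = (ξ.1 <• g⁻¹) <• Γ.a
      rw [smul_smul, smul_smul, ← MulOpposite.op_mul, ← MulOpposite.op_mul]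
      congr 2
      group

/-- Translation by `g⁻¹` followed by the embedding of `𝒯₀` into one of the copies describes the
orbit map `ξ ↦ [ξ ⊗ m]` on the translate `𝒯₀·g`. -/
theorem exists_toOrbit_copy_eq {n : ℕ} (m : (bimoduleM.pow n).carrier) (g : Γ) :
    ∃ i v, ∀ (ξ : Xi) (h : ξ <• g⁻¹ ∈ T₀),
      toOrbit (copy i (T.point h v)) = MN.mk (Tensor.tmul ξ m : XiN n) := by
  obtain ⟨v, k, e⟩ := exists_eq_wordM_smul n (g • m)
  refine ⟨Γ.parity k, v, fun ξ h => ?_⟩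
  rw [toOrbit_copy, MN.mk_eq_mk_iff]
  refine ⟨(aPow (Γ.parity k))⁻¹ * k, ?_, ?_⟩
  · rw [Γ.parity_mul, Γ.parity_inv, parity_aPow, CharTwo.add_self_eq_zero]
  · rw [smul_smul, ← MulOpposite.op_mul, mul_inv_cancel_left]
    change (Tensor.tmul (ξ <• g⁻¹) (wordM n v <• k) : XiN n) = _
    rw [← e, ← Tensor.smul_tmul, smul_smul, ← MulOpposite.op_mul, inv_mul_cancel,
      MulOpposite.op_one, one_smul]

theorem continuous_toOrbit {n : ℕ} : Continuous (toOrbit (n := n)) := by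
  have : Continuous (MN.mk (n := n)) := continuous_quotient_mk'
  exact continuous_sumElim.2 ⟨this.comp continuous_subtype_val, this.comp continuous_subtype_val⟩

theorem continuous_copy_point {n : ℕ} (i : ZMod 2) (v : Fin n → Letter) :
    Continuous fun ξ : T₀ => copy i (T.point ξ.2 v) := by
  unfold copy
  split_ifs
  · exact continuous_inl.comp
      (((continuous_tmul (wordM n v)).comp continuous_subtype_val).subtype_mk _)
  · exact continuous_inr.comp
      (((continuous_tmul (wordM n v <• Γ.a)).comp continuous_subtype_val).subtype_mk _)

theorem surjective_toOrbit {n : ℕ} : Function.Surjective (toOrbit (n := n)) := by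
  rintro ⟨ξ, m⟩
  obtain ⟨g, hg⟩ := exists_mem_of_isChain ξ.isChain
  obtain ⟨i, v, h⟩ := exists_toOrbit_copy_eq m g
  exact ⟨_, h ξ (smul_inv_mem_T₀ hg)⟩

theorem isQuotientMap_toOrbit {n : ℕ} : Topology.IsQuotientMap (toOrbit (n := n)) := by
  refine (Topology.isQuotientMap_iff _).2 ⟨Topology.isCoinducing_iff.2 fun U =>
    ⟨fun hU => ?_, fun h => h.preimage continuous_toOrbit⟩, surjective_toOrbit⟩
  change IsOpen (MN.mk ⁻¹' U)
  refine isOpen_XiN_iff.2 fun m => OrderComplex.isOpen_iff.2 fun s hs => ?_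
  obtain ⟨g, hg⟩ := exists_mem_of_isChain hs
  obtain ⟨i, v, h⟩ := exists_toOrbit_copy_eq m g
  have hmem : ∀ ξ : OrderComplex.face s, ξ.1 <• g⁻¹ ∈ T₀ := fun ξ =>
    smul_inv_mem_T₀ fun S hS => hg S (ξ.2 hS)
  let _ := OrderComplex.faceTopology s
  have hcont : Continuous fun ξ : OrderComplex.face s => copy i (T.point (hmem ξ) v) :=
    (continuous_copy_point i v).comp (((continuous_Xi_smul g⁻¹).comp
      (OrderComplex.continuous_subtype_val_face hs)).subtype_mk hmem)
  convert hU.preimage hcont using 1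
  ext ξ
  change MN.mk (Tensor.tmul ξ.1 m) ∈ U ↔ toOrbit (copy i (T.point (hmem ξ) v)) ∈ U
  rw [h]

/-- The orbit map is constant on the classes of the pasting rules; the induced map is injective by
`mk_eq_mk_of_toOrbit_eq` and a quotient map by `isQuotientMap_toOrbit`. -/
theorem mainTheorem3 (n : ℕ) :
    ∃ Φ : Pasted n ≃ₜ MN n,
      (∀ x : T n, Φ (Pasted.mk (.inl x)) = MN.mk x.1) ∧
      (∀ y : (T n <• Γ.a : Set (XiN n)), Φ (Pasted.mk (.inr y)) = MN.mk y.1) := by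
  let φ : Pasted n → MN n := Quot.lift toOrbit fun _ _ => toOrbit_eq_of_pasteRel
  have hφ : Topology.IsQuotientMap φ :=
    isQuotientMap_toOrbit.of_comp continuous_quot_mk
      (continuous_quot_lift _ continuous_toOrbit)
  have hinj : Function.Injective φ := by
    rintro ⟨y⟩ ⟨z⟩ h
    exact mk_eq_mk_of_toOrbit_eq h
  exact ⟨(Equiv.ofBijective φ ⟨hinj, hφ.surjective⟩).toHomeomorph fun U => hφ.isOpen_preimage,
    fun _ => rfl, fun _ => rfl⟩
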